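/- Let $q\in\mathbb C^\times$ be not a root of unity. Let $U_q(\mathfrak{sl}_2)$ be the algebra with generators $E,F,q^{\pm H}$ and relations $q^HE=qEq^H$, $q^HF=q^{-1}Fq^H$, $[E,F]=(q^{2H}-q^{-2H})/(q-q^{-1})$ (and $q^{H}q^{-H}=q^{-H}q^{H}=1$). Set $$R(u)=(uq-q^{-1})(e_{11}\otimes e_{11}+e_{22}\otimes e_{22})+(u-1)(e_{11}\otimes e_{22}+e_{22}\otimes e_{11})+u(q-q^{-1})\,e_{12}\otimes e_{21}+(q-q^{-1})\,e_{21}\otimes e_{12}.$$ Let $U_q(\widetilde{\mathfrak{gl}}_2)$ be the algebra generated by the coefficients of the series $L^{\pm}_{ij}(u)=L^{(\pm0)}_{ij}+\sum_{s\ge1}L^{(\pm s)}_{ij}u^{\pm s}$, $i,j=1,2$, where $L^{(+0)}_{12}=L^{(-0)}_{21}=0$, subject to $R(u/z)L^{\nu}_{(1)}(u)L^{\nu'}_{(2)}(z)=L^{\nu'}_{(2)}(z)L^{\nu}_{(1)}(u)R(u/z)$ for $(\nu,\nu')=(+,+),(-,-),(+,-)$ and $L^{(+0)}_{ii}L^{(-0)}_{ii}=L^{(-0)}_{ii}L^{(+0)}_{ii}=1$,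 with coproduct $L^\pm_{ij}(u)\mapsto\sum_kL^\pm_{ik}(u)\otimes L^\pm_{kj}(u)$. For $z\in\mathbb C^\times$ and a $U_q(\mathfrak{sl}_2)$-module $V$, let $V(z)$ be the evaluation module, on which $$L^{+}(u)=-M(u/z),\quad L^-(u)=(u/z)^{-1}M(u/z),\quad M(u)=\begin{pmatrix}uq^H-q^{-H}&uF(q-q^{-1})\\E(q-q^{-1})&uq^{-H}-q^{H}\end{pmatrix}.$$ On a tensor product of $n$ evaluation modules $L^+(u)$ acts as a polynomial in $u$, so that $L^+_{ij}(c)$ is a well-defined operator for $c\in\mathbb C$. Let $V_1,\dots,V_n$ be Verma modules over $U_q(\mathfrak{sl}_2)$ with generating vectors $v_1,\dots,v_n$ and highest weights $q^{\Lambda_1},\dots,q^{\Lambda_n}\in\mathbb C^\times$ (so $Ev_m=0$, $q^Hv_m=q^{\Lambda_m}v_m$), and let $z_1,\dots,z_n\in\mathbb C^\times$. **Proposition.** Let $z_i=q^{2\Lambda_i+2\Lambda_j-2\ell}z_j$ for some $i<j$ and $\ell\in\mathbb Z_{\ge0}$. Then: (a) The vector $v_1\otimes\dots\otimes v_n\in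 V_1(z_1)\otimes\dots\otimes V_n(z_n)$ generates a $U_q(\widetilde{\mathfrak{gl}}_2)$-submodule which is annihilated by the product of $\ell+1$ operators $$L^+_{21}(q^{2\Lambda_j}z_j)\,L^+_{21}(q^{2\Lambda_j-2}z_j)\cdots L^+_{21}(q^{2\Lambda_j-2\ell}z_j).$$ (b) The vector $$\tilde v=L^+_{12}(q^{2\Lambda_j}z_j)\,L^+_{12}(q^{2\Lambda_j-2}z_j)\cdots L^+_{12}(q^{2\Lambda_j-2\ell}z_j)\,v_n\otimes\dots\otimes v_1\in V_n(z_n)\otimes\dots\otimes V_1(z_1)$$ is singular with respect to the $U_q(\widetilde{\mathfrak{gl}}_2)$-action, that is, $L^\pm_{21}(u)\,\tilde v=0$. -/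

import Mathlib

open scoped TensorProduct Kronecker

noncomputable section

namespace QLoop

/-! ## The quantum group `U_q(sl_2)` -/

/-- Generators `E`, `F`, `q^H`, `q^{-H}` of the quantum group `U_q(sl_2)`. -/
inductive UqGen
  | E
  | F
  | K
  | Kinv

/-- The defining relations of `U_q(sl_2)`, with `K = q^H` and `Kinv = q^{-H}`. -/
inductive UqRel (q : ℂˣ) : FreeAlgebra ℂ UqGen → FreeAlgebra ℂ UqGen → Prop
  | K_Kinv : UqRel q (FreeAlgebra.ι ℂ UqGen.K * FreeAlgebra.ι ℂ UqGen.Kinv) 1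
  | Kinv_K : UqRel q (FreeAlgebra.ι ℂ UqGen.Kinv * FreeAlgebra.ι ℂ UqGen.K) 1
  | K_E : UqRel q (FreeAlgebra.ι ℂ UqGen.K * FreeAlgebra.ι ℂ UqGen.E)
      ((q : ℂ) • (FreeAlgebra.ι ℂ UqGen.E * FreeAlgebra.ι ℂ UqGen.K))
  | K_F : UqRel q (FreeAlgebra.ι ℂ UqGen.K * FreeAlgebra.ι ℂ UqGen.F)
      ((q : ℂ)⁻¹ • (FreeAlgebra.ι ℂ UqGen.F * FreeAlgebra.ι ℂ UqGen.K))
  | E_F : UqRel q (FreeAlgebra.ι ℂ UqGen.E * FreeAlgebra.ι ℂ UqGen.F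
        - FreeAlgebra.ι ℂ UqGen.F * FreeAlgebra.ι ℂ UqGen.E)
      (((q : ℂ) - (q : ℂ)⁻¹)⁻¹ •
        (FreeAlgebra.ι ℂ UqGen.K ^ 2 - FreeAlgebra.ι ℂ UqGen.Kinv ^ 2))

/-- The quantum group `U_q(sl_2)`, given by generators and relations. -/
def Uq (q : ℂˣ) : Type := RingQuot (UqRel q)

instance (q : ℂˣ) : Ring (Uq q) := inferInstanceAs (Ring (RingQuot (UqRel q)))

instance (q : ℂˣ) : Algebra ℂ (Uq q) := inferInstanceAs (Algebra ℂ (RingQuot (UqRel q)))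

/-- The image of a generator in `U_q(sl_2)`. -/
def Uq.gen (q : ℂˣ) (g : UqGen) : Uq q := RingQuot.mkAlgHom ℂ (UqRel q) (FreeAlgebra.ι ℂ g)

theorem Uq.mk_ι (q : ℂˣ) (g : UqGen) :
    RingQuot.mkAlgHom ℂ (UqRel q) (FreeAlgebra.ι ℂ g) = Uq.gen q g := rfl

theorem Uq.K_Kinv (q : ℂˣ) : Uq.gen q .K * Uq.gen q .Kinv = 1 := by
  have h := RingQuot.mkAlgHom_rel ℂ (UqRel.K_Kinv (q := q))
  rw [map_mul, map_one] at h
  exact h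

theorem Uq.Kinv_K (q : ℂˣ) : Uq.gen q .Kinv * Uq.gen q .K = 1 := by
  have h := RingQuot.mkAlgHom_rel ℂ (UqRel.Kinv_K (q := q))
  rw [map_mul, map_one] at h
  exact h

theorem Uq.K_E (q : ℂˣ) :
    Uq.gen q .K * Uq.gen q .E = (q : ℂ) • (Uq.gen q .E * Uq.gen q .K) := by
  have h := RingQuot.mkAlgHom_rel ℂ (UqRel.K_E (q := q))
  rw [map_mul, map_smul, map_mul] at h
  exact h

theorem Uq.K_F (q : ℂˣ) :
    Uq.gen q .K * Uq.gen q .F = (q : ℂ)⁻¹ • (Uq.gen q .F * Uq.gen q .K) := by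
  have h := RingQuot.mkAlgHom_rel ℂ (UqRel.K_F (q := q))
  rw [map_mul, map_smul, map_mul] at h
  exact h

theorem Uq.E_F (q : ℂˣ) :
    Uq.gen q .E * Uq.gen q .F - Uq.gen q .F * Uq.gen q .E
      = ((q : ℂ) - (q : ℂ)⁻¹)⁻¹ • (Uq.gen q .K ^ 2 - Uq.gen q .Kinv ^ 2) := by
  have h := RingQuot.mkAlgHom_rel ℂ (UqRel.E_F (q := q))
  rw [map_sub, map_mul, map_mul, map_smul, map_sub, map_pow, map_pow] at h
  exact h

/-! ## The quantum loop algebra -/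

/-- The two signs labelling the series `L^+(u)` and `L^-(u)`. -/
inductive Sgn
  | plus
  | minus

/-- A pair of `2 × 2` matrices of formal series
`T^±(u) = ∑_{s ≥ 0} T^±_s u^{±s}` over an algebra, given by the coefficients. -/
abbrev LData (A : Type*) := Sgn → ℕ → Matrix (Fin 2) (Fin 2) A

/-- The coefficient of `u^k`, `k ∈ ℤ`, in the series `T^ν(u)`. -/
def LData.coef {A : Type*} [Zero A] (T : LData A) : Sgn → ℤ → Matrix (Fin 2) (Fin 2) A
  | .plus, k => if 0 ≤ k then T .plus k.toNat else 0
  | .minus, k => if k ≤ 0 then T .minus (-k).toNat else 0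

/-- `T` acting in the first of the two copies of `ℂ²`. -/
def leg1 {A : Type*} [Ring A] (T : Matrix (Fin 2) (Fin 2) A) :
    Matrix (Fin 2 × Fin 2) (Fin 2 × Fin 2) A := T ⊗ₖ (1 : Matrix (Fin 2) (Fin 2) A)

/-- `T` acting in the second of the two copies of `ℂ²`. -/
def leg2 {A : Type*} [Ring A] (T : Matrix (Fin 2) (Fin 2) A) :
    Matrix (Fin 2 × Fin 2) (Fin 2 × Fin 2) A := (1 : Matrix (Fin 2) (Fin 2) A) ⊗ₖ T

/-- The tensor product `e_{ij} ⊗ e_{kl}` of matrix units of size two (indices from `0`). -/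
def unit2 (i j k l : Fin 2) : Matrix (Fin 2 × Fin 2) (Fin 2 × Fin 2) ℂ :=
  Matrix.single i j (1 : ℂ) ⊗ₖ Matrix.single k l (1 : ℂ)

/-- The coefficient of `u` in the trigonometric `R`-matrix
`R(u) = (uq - q⁻¹)(e₁₁⊗e₁₁ + e₂₂⊗e₂₂) + (u-1)(e₁₁⊗e₂₂ + e₂₂⊗e₁₁)
  + u(q - q⁻¹) e₁₂⊗e₂₁ + (q - q⁻¹) e₂₁⊗e₁₂`. -/
def Rlin (q : ℂˣ) : Matrix (Fin 2 × Fin 2) (Fin 2 × Fin 2) ℂ :=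
  (q : ℂ) • (unit2 0 0 0 0 + unit2 1 1 1 1) + (unit2 0 0 1 1 + unit2 1 1 0 0)
    + ((q : ℂ) - (q : ℂ)⁻¹) • unit2 0 1 1 0

/-- The constant term in `u` of the `R`-matrix `R(u)`; thus `R(u) = u • Rlin q + Rconst q`. -/
def Rconst (q : ℂˣ) : Matrix (Fin 2 × Fin 2) (Fin 2 × Fin 2) ℂ :=
  -(q : ℂ)⁻¹ • (unit2 0 0 0 0 + unit2 1 1 1 1) - (unit2 0 0 1 1 + unit2 1 1 0 0)
    + ((q : ℂ) - (q : ℂ)⁻¹) • unit2 1 0 0 1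

/-- A matrix of complex numbers seen as a matrix over a `ℂ`-algebra. -/
def scal (A : Type*) [Ring A] [Algebra ℂ A] (M : Matrix (Fin 2 × Fin 2) (Fin 2 × Fin 2) ℂ) :
    Matrix (Fin 2 × Fin 2) (Fin 2 × Fin 2) A := M.map (algebraMap ℂ A)

/-- The coefficient of `u^r z^s` in `z R(u/z) T^ν_{(1)}(u) T^{ν'}_{(2)}(z)`,
where `z R(u/z) = u • Rlin q + z • Rconst q`. -/
def rttL (q : ℂˣ) {A : Type*} [Ring A] [Algebra ℂ A] (T : LData A) (ν ν' : Sgn) (r s : ℤ) :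
    Matrix (Fin 2 × Fin 2) (Fin 2 × Fin 2) A :=
  scal A (Rlin q) * (leg1 (T.coef ν (r - 1)) * leg2 (T.coef ν' s))
    + scal A (Rconst q) * (leg1 (T.coef ν r) * leg2 (T.coef ν' (s - 1)))

/-- The coefficient of `u^r z^s` in `T^{ν'}_{(2)}(z) T^ν_{(1)}(u) z R(u/z)`. -/
def rttR (q : ℂˣ) {A : Type*} [Ring A] [Algebra ℂ A] (T : LData A) (ν ν' : Sgn) (r s : ℤ) :
    Matrix (Fin 2 × Fin 2) (Fin 2 × Fin 2) A :=
  (leg2 (T.coef ν' s) * leg1 (T.coef ν (r - 1))) * scal A (Rlin q)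
    + (leg2 (T.coef ν' (s - 1)) * leg1 (T.coef ν r)) * scal A (Rconst q)

/-- The pairs of signs for which the exchange relation
`R(u/z) T^ν_{(1)}(u) T^{ν'}_{(2)}(z) = T^{ν'}_{(2)}(z) T^ν_{(1)}(u) R(u/z)` is imposed:
`(+,+)`, `(-,-)` and `(+,-)`. -/
inductive SgnPair : Sgn → Sgn → Prop
  | same (ν : Sgn) : SgnPair ν ν
  | plus_minus : SgnPair .plus .minus

/-- The generator `L^{(+s)}_{ij}` or `L^{(-s)}_{ij}`, `s ≥ 0`, where `+0` and `-0`
are distinguished by the sign. The superfluous ones, `L^{(+0)}_{12}` and `L^{(-0)}_{21}`,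
are set to zero by the relations. -/
structure LoopGen where
  sgn : Sgn
  i : Fin 2
  j : Fin 2
  s : ℕ

/-- The series `L^±(u)` with coefficients in the free algebra on the generators. -/
def freeL : LData (FreeAlgebra ℂ LoopGen) :=
  fun ν s => Matrix.of fun i j => FreeAlgebra.ι ℂ (LoopGen.mk ν i j s)

/-- The defining relations of the quantum loop algebra `U_q(gl_2~)`. -/
inductive LoopRel (q : ℂˣ) : FreeAlgebra ℂ LoopGen → FreeAlgebra ℂ LoopGen → Prop
  | plus_upper : LoopRel q (freeL .plus 0 0 1) 0
  | minus_lower : LoopRel q (freeL .minus 0 1 0) 0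
  | diag_plus_minus (i : Fin 2) : LoopRel q (freeL .plus 0 i i * freeL .minus 0 i i) 1
  | diag_minus_plus (i : Fin 2) : LoopRel q (freeL .minus 0 i i * freeL .plus 0 i i) 1
  | exchange (ν ν' : Sgn) (h : SgnPair ν ν') (r s : ℤ) (a b : Fin 2 × Fin 2) :
      LoopRel q (rttL q freeL ν ν' r s a b) (rttR q freeL ν ν' r s a b)

/-- The quantum loop algebra `U_q(gl_2~)`, given by generators and relations. -/
def LoopAlg (q : ℂˣ) : Type := RingQuot (LoopRel q)

instance (q : ℂˣ) : Ring (LoopAlg q) := inferInstanceAs (Ring (RingQuot (LoopRel q)))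

instance (q : ℂˣ) : Algebra ℂ (LoopAlg q) := inferInstanceAs (Algebra ℂ (RingQuot (LoopRel q)))

/-- `genL q ν s i j` is the coefficient of `u^{νs}` in the series `L^ν_{ij}(u)`
over the quantum loop algebra. -/
def genL (q : ℂˣ) : LData (LoopAlg q) :=
  fun ν s => (freeL ν s).map (RingQuot.mkAlgHom ℂ (LoopRel q))

/-! ### Homomorphisms out of the quantum loop algebra -/

/-- The series `T^±(u)` over an algebra satisfy the relations of the quantum loop algebra. -/
structure IsLOp (q : ℂˣ) {A : Type*} [Ring A] [Algebra ℂ A] (T : LData A) : Prop where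
  plus_upper : T .plus 0 0 1 = 0
  minus_lower : T .minus 0 1 0 = 0
  diag_plus_minus : ∀ i, T .plus 0 i i * T .minus 0 i i = 1
  diag_minus_plus : ∀ i, T .minus 0 i i * T .plus 0 i i = 1
  exchange : ∀ ν ν', SgnPair ν ν' → ∀ r s, rttL q T ν ν' r s = rttR q T ν ν' r s

section Functoriality

variable {A B : Type*} [Ring A] [Algebra ℂ A] [Ring B] [Algebra ℂ B] (f : A →ₐ[ℂ] B)

theorem leg1_map (T : Matrix (Fin 2) (Fin 2) A) : leg1 (T.map f) = (leg1 T).map f := by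
  ext a b
  simp [leg1, Matrix.kroneckerMap_apply, Matrix.one_apply, apply_ite f]

theorem leg2_map (T : Matrix (Fin 2) (Fin 2) A) : leg2 (T.map f) = (leg2 T).map f := by
  ext a b
  simp [leg2, Matrix.kroneckerMap_apply, Matrix.one_apply, apply_ite f]

theorem scal_map (M : Matrix (Fin 2 × Fin 2) (Fin 2 × Fin 2) ℂ) :
    (scal A M).map f = scal B M := by
  ext a b
  simp [scal]

theorem coef_map (T : LData A) (ν : Sgn) (k : ℤ) :
    LData.coef (fun ν s => (T ν s).map f) ν k = (LData.coef T ν k).map f := by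
  cases ν <;> simp only [LData.coef] <;> split_ifs <;> first | rfl | (ext; simp)

theorem rttL_map (q : ℂˣ) (T : LData A) (ν ν' : Sgn) (r s : ℤ) :
    rttL q (fun ν s => (T ν s).map f) ν ν' r s = (rttL q T ν ν' r s).map f := by
  simp only [rttL, coef_map, leg1_map, leg2_map, ← scal_map f]
  simp only [← AlgHom.mapMatrix_apply, map_add, map_mul]

theorem rttR_map (q : ℂˣ) (T : LData A) (ν ν' : Sgn) (r s : ℤ) :
    rttR q (fun ν s => (T ν s).map f) ν ν' r s = (rttR q T ν ν' r s).map f := by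
  simp only [rttR, coef_map, leg1_map, leg2_map, ← scal_map f]
  simp only [← AlgHom.mapMatrix_apply, map_add, map_mul]

theorem IsLOp.map {q : ℂˣ} {T : LData A} (h : IsLOp q T) :
    IsLOp q (fun ν s => (T ν s).map f) where
  plus_upper := by simp [h.plus_upper]
  minus_lower := by simp [h.minus_lower]
  diag_plus_minus i := by simp [← map_mul, h.diag_plus_minus]
  diag_minus_plus i := by simp [← map_mul, h.diag_minus_plus]
  exchange ν ν' hp r s := by rw [rttL_map, rttR_map, h.exchange ν ν' hp]

end Functoriality

theorem isLOp_genL (q : ℂˣ) : IsLOp q (genL q) where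
  plus_upper := by
    have h := RingQuot.mkAlgHom_rel ℂ (LoopRel.plus_upper (q := q))
    rw [map_zero] at h
    exact h
  minus_lower := by
    have h := RingQuot.mkAlgHom_rel ℂ (LoopRel.minus_lower (q := q))
    rw [map_zero] at h
    exact h
  diag_plus_minus i := by
    have h := RingQuot.mkAlgHom_rel ℂ (LoopRel.diag_plus_minus (q := q) i)
    rw [map_mul, map_one] at h
    exact h
  diag_minus_plus i := by
    have h := RingQuot.mkAlgHom_rel ℂ (LoopRel.diag_minus_plus (q := q) i)
    rw [map_mul, map_one] at h
    exact h
  exchange ν ν' hp r s := by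
    have e1 := rttL_map (RingQuot.mkAlgHom ℂ (LoopRel q)) q freeL ν ν' r s
    have e2 := rttR_map (RingQuot.mkAlgHom ℂ (LoopRel q)) q freeL ν ν' r s
    refine e1.trans (Eq.trans ?_ e2.symm)
    ext a b
    exact RingQuot.mkAlgHom_rel ℂ (LoopRel.exchange (q := q) ν ν' hp r s a b)

/-- The homomorphism from the free algebra sending `L^±(u)` to `T^±(u)`. -/
def freeLift {A : Type*} [Ring A] [Algebra ℂ A] (T : LData A) : FreeAlgebra ℂ LoopGen →ₐ[ℂ] A :=
  FreeAlgebra.lift ℂ fun g : LoopGen => T g.sgn g.s g.i g.j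

theorem freeLift_freeL {A : Type*} [Ring A] [Algebra ℂ A] (T : LData A) :
    (fun ν s => (freeL ν s).map (freeLift T)) = T := by
  funext ν s
  ext i j
  simp [freeL, freeLift]

/-- The homomorphism from the quantum loop algebra sending `L^±(u)` to `T^±(u)`. -/
def LoopAlg.lift {q : ℂˣ} {A : Type*} [Ring A] [Algebra ℂ A] (T : LData A) (h : IsLOp q T) :
    LoopAlg q →ₐ[ℂ] A :=
  RingQuot.liftAlgHom ℂ ⟨freeLift T, by
    intro x y hxy
    have key : ∀ ν s i j, freeLift T (freeL ν s i j) = T ν s i j := by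
      intro ν s i j
      simp [freeL, freeLift]
    cases hxy with
    | plus_upper => rw [key, h.plus_upper, map_zero]
    | minus_lower => rw [key, h.minus_lower, map_zero]
    | diag_plus_minus i => rw [map_mul, key, key, h.diag_plus_minus, map_one]
    | diag_minus_plus i => rw [map_mul, key, key, h.diag_minus_plus, map_one]
    | exchange ν ν' hp r s a b =>
      have e1 := rttL_map (freeLift T) q freeL ν ν' r s
      have e2 := rttR_map (freeLift T) q freeL ν ν' r s
      rw [freeLift_freeL] at e1 e2
      have e3 := congrFun (congrFun ((e1.symm.trans (h.exchange ν ν' hp r s)).trans e2) a) b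
      exact e3⟩

theorem LoopAlg.lift_genL {q : ℂˣ} {A : Type*} [Ring A] [Algebra ℂ A] (T : LData A)
    (h : IsLOp q T) (ν : Sgn) (s : ℕ) (i j : Fin 2) :
    LoopAlg.lift T h (genL q ν s i j) = T ν s i j := by
  have e : LoopAlg.lift T h (genL q ν s i j) = freeLift T (freeL ν s i j) := by
    unfold LoopAlg.lift genL
    exact RingQuot.liftAlgHom_mkAlgHom_apply _ _ _ _
  rw [e]
  simp [freeL, freeLift]

section Entries

variable {A : Type*} [Ring A] [Algebra ℂ A]

theorem leg1_mul_leg2_apply {A : Type*} [Ring A] (X Y : Matrix (Fin 2) (Fin 2) A) (a b a' b' : Fin 2) :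
    (leg1 X * leg2 Y) (a, b) (a', b') = X a a' * Y b b' := by
  simp [leg1, leg2, Matrix.mul_apply, Fintype.sum_prod_type, Matrix.one_apply]

theorem leg2_mul_leg1_apply {A : Type*} [Ring A] (X Y : Matrix (Fin 2) (Fin 2) A) (a b a' b' : Fin 2) :
    (leg2 Y * leg1 X) (a, b) (a', b') = Y b b' * X a a' := by
  simp [leg1, leg2, Matrix.mul_apply, Fintype.sum_prod_type, Matrix.one_apply]

variable (q : ℂˣ) (M : Matrix (Fin 2 × Fin 2) (Fin 2 × Fin 2) A) (p : Fin 2 × Fin 2)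

theorem Rlin_mul :
    (scal A (Rlin q) * M) (0, 0) p = (q : ℂ) • M (0, 0) p ∧
    (scal A (Rlin q) * M) (0, 1) p = M (0, 1) p + ((q : ℂ) - (q : ℂ)⁻¹) • M (1, 0) p ∧
    (scal A (Rlin q) * M) (1, 0) p = M (1, 0) p ∧
    (scal A (Rlin q) * M) (1, 1) p = (q : ℂ) • M (1, 1) p := by
  simp [scal, Rlin, unit2, Matrix.mul_apply, Fintype.sum_prod_type,
    Algebra.algebraMap_eq_smul_one, Matrix.single_apply]

theorem Rconst_mul :
    (scal A (Rconst q) * M) (0, 0) p = -(q : ℂ)⁻¹ • M (0, 0) p ∧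
    (scal A (Rconst q) * M) (0, 1) p = -M (0, 1) p ∧
    (scal A (Rconst q) * M) (1, 0) p = -M (1, 0) p + ((q : ℂ) - (q : ℂ)⁻¹) • M (0, 1) p ∧
    (scal A (Rconst q) * M) (1, 1) p = -(q : ℂ)⁻¹ • M (1, 1) p := by
  simp [scal, Rconst, unit2, Matrix.mul_apply, Fintype.sum_prod_type,
    Algebra.algebraMap_eq_smul_one, Matrix.single_apply, add_comm]

theorem mul_Rlin :
    (M * scal A (Rlin q)) p (0, 0) = (q : ℂ) • M p (0, 0) ∧
    (M * scal A (Rlin q)) p (0, 1) = M p (0, 1) ∧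
    (M * scal A (Rlin q)) p (1, 0) = M p (1, 0) + ((q : ℂ) - (q : ℂ)⁻¹) • M p (0, 1) ∧
    (M * scal A (Rlin q)) p (1, 1) = (q : ℂ) • M p (1, 1) := by
  simp [scal, Rlin, unit2, Matrix.mul_apply, Fintype.sum_prod_type,
    Algebra.algebraMap_eq_smul_one, Matrix.single_apply, add_comm]

theorem mul_Rconst :
    (M * scal A (Rconst q)) p (0, 0) = -(q : ℂ)⁻¹ • M p (0, 0) ∧
    (M * scal A (Rconst q)) p (0, 1) = -M p (0, 1) + ((q : ℂ) - (q : ℂ)⁻¹) • M p (1, 0) ∧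
    (M * scal A (Rconst q)) p (1, 0) = -M p (1, 0) ∧
    (M * scal A (Rconst q)) p (1, 1) = -(q : ℂ)⁻¹ • M p (1, 1) := by
  simp [scal, Rconst, unit2, Matrix.mul_apply, Fintype.sum_prod_type,
    Algebra.algebraMap_eq_smul_one, Matrix.single_apply, add_comm]

end Entries

/-! ### The evaluation homomorphism -/

theorem Uq.Kinv_E (q : ℂˣ) :
    Uq.gen q .Kinv * Uq.gen q .E = (q : ℂ)⁻¹ • (Uq.gen q .E * Uq.gen q .Kinv) := by
  have h : Uq.gen q .Kinv * (Uq.gen q .K * Uq.gen q .E) * Uq.gen q .Kinv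
      = Uq.gen q .Kinv * ((q : ℂ) • (Uq.gen q .E * Uq.gen q .K)) * Uq.gen q .Kinv := by
    rw [Uq.K_E]
  rw [← mul_assoc, Uq.Kinv_K, one_mul, mul_smul_comm, smul_mul_assoc, mul_assoc, mul_assoc,
    Uq.K_Kinv, mul_one] at h
  rw [h, smul_smul, inv_mul_cancel₀ q.ne_zero, one_smul]

theorem Uq.Kinv_F (q : ℂˣ) :
    Uq.gen q .Kinv * Uq.gen q .F = (q : ℂ) • (Uq.gen q .F * Uq.gen q .Kinv) := by
  have h : Uq.gen q .Kinv * (Uq.gen q .K * Uq.gen q .F) * Uq.gen q .Kinv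
      = Uq.gen q .Kinv * ((q : ℂ)⁻¹ • (Uq.gen q .F * Uq.gen q .K)) * Uq.gen q .Kinv := by
    rw [Uq.K_F]
  rw [← mul_assoc, Uq.Kinv_K, one_mul, mul_smul_comm, smul_mul_assoc, mul_assoc, mul_assoc,
    Uq.K_Kinv, mul_one] at h
  rw [h, smul_smul, mul_inv_cancel₀ q.ne_zero, one_smul]

/-- The coefficient of `u^k` in the matrix
`(u q^H - q^{-H}, u F (q - q⁻¹); E (q - q⁻¹), u q^{-H} - q^H)` over `U_q(sl_2)`. -/
def evalMat (q : ℂˣ) (k : ℤ) : Matrix (Fin 2) (Fin 2) (Uq q) :=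
  if k = 0 then !![-Uq.gen q .Kinv, 0; ((q : ℂ) - (q : ℂ)⁻¹) • Uq.gen q .E, -Uq.gen q .K]
  else if k = 1 then !![Uq.gen q .K, ((q : ℂ) - (q : ℂ)⁻¹) • Uq.gen q .F; 0, Uq.gen q .Kinv]
  else 0

/-- The images of the series `L^±(u)` under the evaluation homomorphism: with `M(u)` the matrix
of `evalMat`, one has `L^+(u) ↦ -M(u)` and `L^-(u) ↦ u⁻¹ M(u)`. -/
def evalL (q : ℂˣ) : LData (Uq q)
  | .plus, s => -evalMat q s
  | .minus, s => evalMat q (1 - s)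

theorem evalL_coef_plus (q : ℂˣ) (k : ℤ) : (evalL q).coef .plus k = -evalMat q k := by
  simp only [LData.coef, evalL]
  split_ifs with h
  · rw [Int.toNat_of_nonneg h]
  · rw [evalMat, if_neg (by omega), if_neg (by omega), neg_zero]

theorem evalL_coef_minus (q : ℂˣ) (k : ℤ) : (evalL q).coef .minus k = evalMat q (k + 1) := by
  simp only [LData.coef, evalL]
  split_ifs with h
  · rw [Int.toNat_of_nonneg (by omega)]
    congr 1
    ring
  · rw [evalMat, if_neg (by omega), if_neg (by omega)]

theorem Uq.E_F' (q : ℂˣ) :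
    Uq.gen q .E * Uq.gen q .F = Uq.gen q .F * Uq.gen q .E
      + ((q : ℂ) - (q : ℂ)⁻¹)⁻¹ • (Uq.gen q .K * Uq.gen q .K - Uq.gen q .Kinv * Uq.gen q .Kinv) := by
  rw [← sq, ← sq, ← Uq.E_F, add_sub_cancel]

set_option maxHeartbeats 1000000 in
theorem evalMat_exchange (q : ℂˣ) (r s : ℤ) :
    scal (Uq q) (Rlin q) * (leg1 (evalMat q (r - 1)) * leg2 (evalMat q s))
      + scal (Uq q) (Rconst q) * (leg1 (evalMat q r) * leg2 (evalMat q (s - 1)))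
    = (leg2 (evalMat q s) * leg1 (evalMat q (r - 1))) * scal (Uq q) (Rlin q)
      + (leg2 (evalMat q (s - 1)) * leg1 (evalMat q r)) * scal (Uq q) (Rconst q) := by
  have hq := q.ne_zero
  have h1 := Uq.K_Kinv q
  have h2 := Uq.Kinv_K q
  have h3 := Uq.K_E q
  have h4 := Uq.K_F q
  have h5 := Uq.Kinv_E q
  have h6 := Uq.Kinv_F q
  have h7 := Uq.E_F' q
  have big : ∀ k : ℤ, k < 0 ∨ 1 < k → evalMat q k = 0 := by
    intro k hk
    rw [evalMat, if_neg (by omega), if_neg (by omega)]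
  have l1 : leg1 (0 : Matrix (Fin 2) (Fin 2) (Uq q)) = 0 := by simp [leg1]
  have l2 : leg2 (0 : Matrix (Fin 2) (Fin 2) (Uq q)) = 0 := by simp [leg2]
  have e0 : evalMat q 0 =
    !![-Uq.gen q .Kinv, 0; ((q : ℂ) - (q : ℂ)⁻¹) • Uq.gen q .E, -Uq.gen q .K] := by simp [evalMat]
  have e1 : evalMat q 1 =
    !![Uq.gen q .K, ((q : ℂ) - (q : ℂ)⁻¹) • Uq.gen q .F; 0, Uq.gen q .Kinv] := by simp [evalMat]
  generalize hc : (q : ℂ) - (q : ℂ)⁻¹ = c at *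
  generalize Uq.gen q .K = K at *
  generalize Uq.gen q .Kinv = Ki at *
  generalize Uq.gen q .E = E at *
  generalize Uq.gen q .F = F at *
  by_cases hr : r < 0 ∨ 2 < r
  · rw [big r (by omega), big (r - 1) (by omega), l1]
    simp
  by_cases hs : s < 0 ∨ 2 < s
  · rw [big s (by omega), big (s - 1) (by omega), l2]
    simp
  have b2 : evalMat q 2 = 0 := big 2 (by norm_num)
  have b3 : evalMat q (-1) = 0 := big (-1) (by norm_num)
  have hr1 : 0 ≤ r := by omega
  have hr2 : r ≤ 2 := by omega
  have hs1 : 0 ≤ s := by omega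
  have hs2 : s ≤ 2 := by omega
  have h8 : c • c • (E * F) = c • c • (F * E) + c • (K * K - Ki * Ki) := by
    rw [h7, smul_add, smul_add, smul_smul c c⁻¹, smul_smul c (c * c⁻¹), ← mul_assoc,
      mul_self_mul_inv]
  clear big hr hs
  interval_cases r <;> interval_cases s <;>
    norm_num only [l1, l2, e0, e1, b2, b3, mul_zero, zero_mul, add_zero, zero_add] <;>
    refine Matrix.ext (Prod.forall.2 fun a b => Prod.forall.2 fun a' b' => ?_) <;>
    try rw [Matrix.add_apply, Matrix.add_apply]
  all_goals
    fin_cases a <;> fin_cases b <;> fin_cases a' <;> fin_cases b' <;>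
    simp [Rlin_mul, Rconst_mul, mul_Rlin, mul_Rconst, leg1_mul_leg2_apply, leg2_mul_leg1_apply, hc]
  all_goals
    first
    | abel1
    | simp only [h1, h2]
    | (simp only [h8, smul_sub]; abel1)
    | (simp only [h3, h4, h5, h6, ← hc]
       match_scalars
       all_goals
         field_simp
       all_goals ring)

theorem leg1_neg {A : Type*} [Ring A] (X : Matrix (Fin 2) (Fin 2) A) : leg1 (-X) = -leg1 X := by
  ext a b
  simp [leg1]

theorem leg2_neg {A : Type*} [Ring A] (X : Matrix (Fin 2) (Fin 2) A) : leg2 (-X) = -leg2 X := by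
  ext a b
  simp [leg2]

theorem isLOp_evalL (q : ℂˣ) : IsLOp q (evalL q) where
  plus_upper := by simp [evalL, evalMat]
  minus_lower := by simp [evalL, evalMat]
  diag_plus_minus i := by
    fin_cases i <;> simp [evalL, evalMat, Uq.K_Kinv, Uq.Kinv_K]
  diag_minus_plus i := by
    fin_cases i <;> simp [evalL, evalMat, Uq.K_Kinv, Uq.Kinv_K]
  exchange ν ν' hp r s := by
    cases hp with
    | same =>
      cases ν with
      | plus =>
        simp only [rttL, rttR, evalL_coef_plus, leg1_neg, leg2_neg, neg_mul_neg]
        exact evalMat_exchange q r s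
      | minus =>
        have h := evalMat_exchange q (r + 1) (s + 1)
        simp only [rttL, rttR, evalL_coef_minus, sub_add_cancel]
        simpa only [add_sub_cancel_right] using h
    | plus_minus =>
      have h := evalMat_exchange q r (s + 1)
      simp only [add_sub_cancel_right] at h
      simp only [rttL, rttR, evalL_coef_plus, evalL_coef_minus, sub_add_cancel, leg1_neg,
        neg_mul, mul_neg, ← neg_add]
      rw [h]

/-- The evaluation homomorphism `U_q(gl_2~) → U_q(sl_2)`. -/
def evalHom (q : ℂˣ) : LoopAlg q →ₐ[ℂ] Uq q := LoopAlg.lift (evalL q) (isLOp_evalL q)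

/-! ### The automorphisms `ρ_z` -/

/-- The coefficients of the rescaled series `T^±(u/z)`. -/
def LData.rescale {A : Type*} [Ring A] [Algebra ℂ A] (T : LData A) (z : ℂˣ) : LData A
  | .plus, s => ((z : ℂ)⁻¹ ^ s) • T .plus s
  | .minus, s => ((z : ℂ) ^ s) • T .minus s

theorem coef_rescale {A : Type*} [Ring A] [Algebra ℂ A] (T : LData A) (z : ℂˣ) (ν : Sgn) (k : ℤ) :
    (T.rescale z).coef ν k = ((z : ℂ) ^ (-k)) • T.coef ν k := by
  cases ν <;> simp only [LData.coef, LData.rescale] <;> split_ifs with h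
  · obtain ⟨m, rfl⟩ := Int.eq_ofNat_of_zero_le h
    simp
  · simp
  · obtain ⟨m, hm⟩ := Int.eq_ofNat_of_zero_le (neg_nonneg.2 h)
    rw [hm]
    simp
  · simp

theorem leg1_smul {A : Type*} [Ring A] [Algebra ℂ A] (c : ℂ) (X : Matrix (Fin 2) (Fin 2) A) :
    leg1 (c • X) = c • leg1 X := Matrix.smul_kronecker c X 1

theorem leg2_smul {A : Type*} [Ring A] [Algebra ℂ A] (c : ℂ) (X : Matrix (Fin 2) (Fin 2) A) :
    leg2 (c • X) = c • leg2 X := Matrix.kronecker_smul c 1 X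

theorem IsLOp.rescale {q : ℂˣ} {A : Type*} [Ring A] [Algebra ℂ A] {T : LData A}
    (h : IsLOp q T) (z : ℂˣ) : IsLOp q (T.rescale z) where
  plus_upper := by simp [LData.rescale, h.plus_upper]
  minus_lower := by simp [LData.rescale, h.minus_lower]
  diag_plus_minus i := by simp [LData.rescale, h.diag_plus_minus]
  diag_minus_plus i := by simp [LData.rescale, h.diag_minus_plus]
  exchange ν ν' hp r s := by
    have hz : (z : ℂ) ≠ 0 := z.ne_zero
    have e1 : (z : ℂ) ^ (-(r - 1)) * (z : ℂ) ^ (-s) = (z : ℂ) ^ (1 - r - s) := by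
      rw [← zpow_add₀ hz]
      congr 1
      ring
    have e2 : (z : ℂ) ^ (-r) * (z : ℂ) ^ (-(s - 1)) = (z : ℂ) ^ (1 - r - s) := by
      rw [← zpow_add₀ hz]
      congr 1
      ring
    have key := congrArg (fun M => ((z : ℂ) ^ (1 - r - s)) • M) (h.exchange ν ν' hp r s)
    simp only [rttL, rttR, smul_add] at key
    simp only [rttL, rttR, coef_rescale, leg1_smul, leg2_smul, smul_mul_assoc, mul_smul_comm,
      smul_smul, mul_comm ((z : ℂ) ^ (-s)), mul_comm ((z : ℂ) ^ (-(s - 1))), e1, e2]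
    exact key

/-- The homomorphism `ρ_z : L^±(u) ↦ L^±(u/z)` of the quantum loop algebra. -/
def shiftHom (q : ℂˣ) (z : ℂˣ) : LoopAlg q →ₐ[ℂ] LoopAlg q :=
  LoopAlg.lift ((genL q).rescale z) ((isLOp_genL q).rescale z)

/-! ### Counit and coproduct -/

/-- The images of the series `L^±(u)` under the counit: the identity matrix. -/
def counitL : LData ℂ := fun _ s => if s = 0 then 1 else 0

theorem isLOp_counitL (q : ℂˣ) : IsLOp q counitL where
  plus_upper := by simp [counitL]
  minus_lower := by simp [counitL]
  diag_plus_minus i := by simp [counitL]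
  diag_minus_plus i := by simp [counitL]
  exchange ν ν' _ r s := by
    have h : ∀ ν k, counitL.coef ν k = if k = 0 then 1 else 0 := by
      intro ν k
      cases ν <;> simp only [LData.coef, counitL] <;> split_ifs <;> first | rfl | omega
    have l1 : leg1 (1 : Matrix (Fin 2) (Fin 2) ℂ) = 1 := Matrix.one_kronecker_one
    have l2 : leg2 (1 : Matrix (Fin 2) (Fin 2) ℂ) = 1 := Matrix.one_kronecker_one
    have l3 : leg1 (0 : Matrix (Fin 2) (Fin 2) ℂ) = 0 := by simp [leg1]
    have l4 : leg2 (0 : Matrix (Fin 2) (Fin 2) ℂ) = 0 := by simp [leg2]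
    simp only [rttL, rttR, h]
    split_ifs <;> simp [l1, l2, l3, l4]

/-- The counit `L^±_{ij}(u) ↦ δ_{ij}` of the quantum loop algebra. -/
def counit (q : ℂˣ) : LoopAlg q →ₐ[ℂ] ℂ := LoopAlg.lift counitL (isLOp_counitL q)

section Conv

variable {A : Type*} [Ring A]

/-- The coefficients of the product `T(u) T'(u)` of two matrices of series. -/
def LData.conv (T T' : LData A) : LData A :=
  fun ν s => ∑ p ∈ Finset.HasAntidiagonal.antidiagonal s, T ν p.1 * T' ν p.2

variable {M : Type*} [Ring M]

/-- The series `∑ f_n x^n` in two variables `x, y`. -/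
def serX (f : ℕ → M) : PowerSeries (PowerSeries M) := PowerSeries.mk fun n => PowerSeries.C (f n)

/-- The series `∑ f_n y^n` in two variables `x, y`. -/
def serY (f : ℕ → M) : PowerSeries (PowerSeries M) := PowerSeries.C (PowerSeries.mk f)

/-- A constant as a series in two variables. -/
def serC (a : M) : PowerSeries (PowerSeries M) := PowerSeries.C (PowerSeries.C a)

theorem serX_conv (f g : ℕ → M) :
    serX (fun n => ∑ p ∈ Finset.HasAntidiagonal.antidiagonal n, f p.1 * g p.2) = serX f * serX g := by
  refine PowerSeries.ext fun n => ?_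
  simp [serX, PowerSeries.coeff_mul]

theorem serY_conv (f g : ℕ → M) :
    serY (fun n => ∑ p ∈ Finset.HasAntidiagonal.antidiagonal n, f p.1 * g p.2) = serY f * serY g := by
  rw [serY, serY, serY, ← map_mul]
  congr 1
  refine PowerSeries.ext fun n => ?_
  simp [PowerSeries.coeff_mul]

theorem serX_comm_serY (f g : ℕ → M) (h : ∀ m n, f m * g n = g n * f m) :
    serX f * serY g = serY g * serX f := by
  refine PowerSeries.ext fun n => PowerSeries.ext fun m => ?_
  simp [serX, serY, h]

theorem coeff_serX_serY (f g : ℕ → M) (m n : ℕ) :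
    PowerSeries.coeff n (PowerSeries.coeff m (serX f * serY g)) = f m * g n := by
  simp [serX, serY]

theorem coeff_serY_serX (f g : ℕ → M) (m n : ℕ) :
    PowerSeries.coeff n (PowerSeries.coeff m (serY g * serX f)) = g n * f m := by
  simp [serX, serY]

theorem coeff_serC_mul (a : M) (S : PowerSeries (PowerSeries M)) (m n : ℕ) :
    PowerSeries.coeff n (PowerSeries.coeff m (serC a * S))
      = a * PowerSeries.coeff n (PowerSeries.coeff m S) := by
  simp [serC]

theorem coeff_mul_serC (a : M) (S : PowerSeries (PowerSeries M)) (m n : ℕ) :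
    PowerSeries.coeff n (PowerSeries.coeff m (S * serC a))
      = PowerSeries.coeff n (PowerSeries.coeff m S) * a := by
  simp [serC]

/-- The variable `x`. -/
def varX : PowerSeries (PowerSeries M) := PowerSeries.X

/-- The variable `y`. -/
def varY : PowerSeries (PowerSeries M) := PowerSeries.C PowerSeries.X

theorem varX_comm (S : PowerSeries (PowerSeries M)) : S * varX = varX * S :=
  (PowerSeries.commute_X S).eq

theorem varY_comm (S : PowerSeries (PowerSeries M)) : S * varY = varY * S := by
  refine PowerSeries.ext fun n => ?_
  simp only [varY, PowerSeries.coeff_mul_C, PowerSeries.coeff_C_mul]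
  exact (PowerSeries.commute_X _).eq

/-- The two-variable coefficients of a series, extended by zero to all integers. -/
def coefZ (S : PowerSeries (PowerSeries M)) (r s : ℤ) : M :=
  if 0 ≤ r ∧ 0 ≤ s then PowerSeries.coeff s.toNat (PowerSeries.coeff r.toNat S) else 0

theorem coefZ_ext {S S' : PowerSeries (PowerSeries M)} :
    S = S' ↔ ∀ r s, coefZ S r s = coefZ S' r s := by
  refine ⟨fun h r s => by rw [h], fun h => PowerSeries.ext fun m => PowerSeries.ext fun n => ?_⟩
  have := h m n
  simpa [coefZ] using this

theorem coefZ_add (S S' : PowerSeries (PowerSeries M)) (r s : ℤ) :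
    coefZ (S + S') r s = coefZ S r s + coefZ S' r s := by
  simp only [coefZ]
  split_ifs <;> simp

theorem coefZ_varX (S : PowerSeries (PowerSeries M)) (r s : ℤ) :
    coefZ (varX * S) r s = coefZ S (r - 1) s := by
  rcases lt_or_ge r 0 with h | h
  · rw [coefZ, coefZ, if_neg (by omega), if_neg (by omega)]
  · obtain ⟨m, rfl⟩ := Int.eq_ofNat_of_zero_le h
    cases m with
    | zero => simp [coefZ, varX]
    | succ m => simp [coefZ, varX, PowerSeries.coeff_succ_X_mul, add_nonneg]

theorem coefZ_varY (S : PowerSeries (PowerSeries M)) (r s : ℤ) :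
    coefZ (varY * S) r s = coefZ S r (s - 1) := by
  rcases lt_or_ge s 0 with h | h
  · rw [coefZ, coefZ, if_neg (by omega), if_neg (by omega)]
  · obtain ⟨m, rfl⟩ := Int.eq_ofNat_of_zero_le h
    cases m with
    | zero => simp [coefZ, varY]
    | succ m => simp [coefZ, varY, PowerSeries.coeff_succ_X_mul, add_nonneg]

theorem coefZ_serC_mul (a : M) (S : PowerSeries (PowerSeries M)) (r s : ℤ) :
    coefZ (serC a * S) r s = a * coefZ S r s := by
  simp only [coefZ]
  split_ifs <;> simp [coeff_serC_mul]

theorem coefZ_mul_serC (a : M) (S : PowerSeries (PowerSeries M)) (r s : ℤ) :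
    coefZ (S * serC a) r s = coefZ S r s * a := by
  simp only [coefZ]
  split_ifs <;> simp [coeff_mul_serC]

end Conv

section Legs

variable {A : Type*} [Ring A]

theorem leg1_zero : leg1 (0 : Matrix (Fin 2) (Fin 2) A) = 0 := by simp [leg1]

theorem leg2_zero : leg2 (0 : Matrix (Fin 2) (Fin 2) A) = 0 := by simp [leg2]

theorem leg1_mul (X Y : Matrix (Fin 2) (Fin 2) A) : leg1 (X * Y) = leg1 X * leg1 Y := by
  refine Matrix.ext (Prod.forall.2 fun a b => Prod.forall.2 fun a' b' => ?_)
  simp [leg1, Matrix.mul_apply, Fintype.sum_prod_type, Matrix.one_apply]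

theorem leg2_mul (X Y : Matrix (Fin 2) (Fin 2) A) : leg2 (X * Y) = leg2 X * leg2 Y := by
  refine Matrix.ext (Prod.forall.2 fun a b => Prod.forall.2 fun a' b' => ?_)
  simp [leg2, Matrix.mul_apply, Fintype.sum_prod_type, Matrix.one_apply]

theorem leg1_sum {ι : Type*} (s : Finset ι) (X : ι → Matrix (Fin 2) (Fin 2) A) :
    leg1 (∑ p ∈ s, X p) = ∑ p ∈ s, leg1 (X p) := by
  refine Matrix.ext (Prod.forall.2 fun a b => Prod.forall.2 fun a' b' => ?_)
  simp [leg1, Matrix.sum_apply, Finset.sum_mul]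

theorem leg2_sum {ι : Type*} (s : Finset ι) (X : ι → Matrix (Fin 2) (Fin 2) A) :
    leg2 (∑ p ∈ s, X p) = ∑ p ∈ s, leg2 (X p) := by
  refine Matrix.ext (Prod.forall.2 fun a b => Prod.forall.2 fun a' b' => ?_)
  simp [leg2, Matrix.sum_apply, Finset.mul_sum]

theorem leg_comm (X Y : Matrix (Fin 2) (Fin 2) A) (h : ∀ i j k l, X i j * Y k l = Y k l * X i j) :
    leg1 X * leg2 Y = leg2 Y * leg1 X := by
  refine Matrix.ext (Prod.forall.2 fun a b => Prod.forall.2 fun a' b' => ?_)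
  rw [leg1_mul_leg2_apply, leg2_mul_leg1_apply, h]

end Legs

section Coproduct

variable {A : Type*} [Ring A]

/-- The `R`-matrix in the variables `x = u^{±1}`, `y = z^{±1}`, up to a monomial factor. -/
def Rser (q : ℂˣ) (A : Type*) [Ring A] [Algebra ℂ A] :
    Sgn → Sgn → PowerSeries (PowerSeries (Matrix (Fin 2 × Fin 2) (Fin 2 × Fin 2) A))
  | .plus, .plus => varX * serC (scal A (Rlin q)) + varY * serC (scal A (Rconst q))
  | .minus, .minus => varY * serC (scal A (Rlin q)) + varX * serC (scal A (Rconst q))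
  | .plus, .minus => varX * (varY * serC (scal A (Rlin q))) + serC (scal A (Rconst q))
  | .minus, .plus => 0

/-- The series of operators acting in the first copy of `ℂ²`. -/
def serL1 (T : LData A) (ν : Sgn) :
    PowerSeries (PowerSeries (Matrix (Fin 2 × Fin 2) (Fin 2 × Fin 2) A)) :=
  serX fun n => leg1 (T ν n)

/-- The series of operators acting in the second copy of `ℂ²`. -/
def serL2 (T : LData A) (ν : Sgn) :
    PowerSeries (PowerSeries (Matrix (Fin 2 × Fin 2) (Fin 2 × Fin 2) A)) :=
  serY fun n => leg2 (T ν n)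

/-- The exponent of `u` corresponding to the exponent of `u^{±1}`. -/
def Sgn.act : Sgn → ℤ → ℤ
  | .plus, k => k
  | .minus, k => -k

theorem coefZ_L1_L2 (T : LData A) (ν ν' : Sgn) (r s : ℤ) :
    coefZ (serL1 T ν * serL2 T ν') r s
      = leg1 (T.coef ν (ν.act r)) * leg2 (T.coef ν' (ν'.act s)) := by
  simp only [coefZ, serL1, serL2, coeff_serX_serY]
  split_ifs with h
  · cases ν <;> cases ν' <;> simp [LData.coef, Sgn.act, h]
  · rcases not_and_or.1 h with h | h <;> cases ν <;> cases ν' <;>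
      simp [LData.coef, Sgn.act, h, leg1_zero, leg2_zero]

theorem coefZ_L2_L1 (T : LData A) (ν ν' : Sgn) (r s : ℤ) :
    coefZ (serL2 T ν' * serL1 T ν) r s
      = leg2 (T.coef ν' (ν'.act s)) * leg1 (T.coef ν (ν.act r)) := by
  simp only [coefZ, serL1, serL2, coeff_serY_serX]
  split_ifs with h
  · cases ν <;> cases ν' <;> simp [LData.coef, Sgn.act, h]
  · rcases not_and_or.1 h with h | h <;> cases ν <;> cases ν' <;>
      simp [LData.coef, Sgn.act, h, leg1_zero, leg2_zero]

theorem exchange_iff [Algebra ℂ A] (q : ℂˣ) (T : LData A) (ν ν' : Sgn) (hp : SgnPair ν ν') :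
    (∀ r s, rttL q T ν ν' r s = rttR q T ν ν' r s) ↔
      Rser q A ν ν' * (serL1 T ν * serL2 T ν') = (serL2 T ν' * serL1 T ν) * Rser q A ν ν' := by
  rw [coefZ_ext]
  cases hp with
  | same =>
    cases ν with
    | plus =>
      simp only [Rser, add_mul, mul_add, ← mul_assoc _ varX, ← mul_assoc _ varY, varX_comm,
        varY_comm, mul_assoc varX, mul_assoc varY, coefZ_add, coefZ_varX, coefZ_varY,
        coefZ_serC_mul, coefZ_mul_serC, coefZ_L1_L2, coefZ_L2_L1, Sgn.act, rttL, rttR]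
    | minus =>
      simp only [Rser, add_mul, mul_add, ← mul_assoc _ varX, ← mul_assoc _ varY, varX_comm,
        varY_comm, mul_assoc varX, mul_assoc varY, coefZ_add, coefZ_varX, coefZ_varY,
        coefZ_serC_mul, coefZ_mul_serC, coefZ_L1_L2, coefZ_L2_L1, Sgn.act, rttL, rttR]
      constructor
      · intro h r s
        have := h (1 - r) (1 - s)
        simp only [sub_sub_cancel_left] at this
        simpa only [neg_sub] using this
      · intro h r s
        have := h (1 - r) (1 - s)
        simp only [sub_sub_cancel_left, neg_neg] at this
        simpa only [neg_sub] using this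
  | plus_minus =>
    have e : ∀ (P : PowerSeries (PowerSeries (Matrix (Fin 2 × Fin 2) (Fin 2 × Fin 2) A))) a,
        P * (varX * (varY * serC a)) = varX * (varY * (P * serC a)) := by
      intro P a
      rw [← mul_assoc, varX_comm, mul_assoc, ← mul_assoc P, varY_comm, mul_assoc]
    simp only [Rser, add_mul, mul_add, e, mul_assoc varX, mul_assoc varY, coefZ_add, coefZ_varX,
      coefZ_varY, coefZ_serC_mul, coefZ_mul_serC, coefZ_L1_L2, coefZ_L2_L1, Sgn.act, rttL, rttR]
    constructor
    · intro h r s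
      have := h r (1 - s)
      simp only [sub_sub_cancel_left] at this
      simpa only [neg_sub] using this
    · intro h r s
      have := h r (1 - s)
      simp only [sub_sub_cancel_left, neg_neg] at this
      simpa only [neg_sub] using this

theorem serL1_conv (T T' : LData A) (ν : Sgn) :
    serL1 (T.conv T') ν = serL1 T ν * serL1 T' ν := by
  rw [serL1, serL1, serL1, ← serX_conv]
  simp only [LData.conv, leg1_sum, leg1_mul]

theorem serL2_conv (T T' : LData A) (ν : Sgn) :
    serL2 (T.conv T') ν = serL2 T ν * serL2 T' ν := by
  rw [serL2, serL2, serL2, ← serY_conv]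
  simp only [LData.conv, leg2_sum, leg2_mul]

theorem IsLOp.conv [Algebra ℂ A] {q : ℂˣ} {T T' : LData A} (h : IsLOp q T) (h' : IsLOp q T')
    (hc : ∀ ν ν' m n i j k l, T ν m i j * T' ν' n k l = T' ν' n k l * T ν m i j) :
    IsLOp q (T.conv T') where
  plus_upper := by
    simp [LData.conv, Matrix.mul_apply, h.plus_upper, h'.plus_upper]
  minus_lower := by
    simp [LData.conv, Matrix.mul_apply, h.minus_lower, h'.minus_lower]
  diag_plus_minus i := by
    have e : ∀ a b c d : A, a * b * (c * d) = a * (b * c) * d := fun a b c d => by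
      simp only [mul_assoc]
    fin_cases i <;> simp [LData.conv, Matrix.mul_apply, h.plus_upper, h'.plus_upper,
      h.minus_lower, h'.minus_lower, e, ← hc]
    all_goals
      simp [← mul_assoc, h.diag_plus_minus, h'.diag_plus_minus]
  diag_minus_plus i := by
    have e : ∀ a b c d : A, a * b * (c * d) = a * (b * c) * d := fun a b c d => by
      simp only [mul_assoc]
    fin_cases i <;> simp [LData.conv, Matrix.mul_apply, h.plus_upper, h'.plus_upper,
      h.minus_lower, h'.minus_lower, e, ← hc]
    all_goals
      simp [← mul_assoc, h.diag_minus_plus, h'.diag_minus_plus]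
  exchange ν ν' hp := by
    rw [exchange_iff q _ ν ν' hp, serL1_conv, serL2_conv]
    have e1 := (exchange_iff q _ ν ν' hp).1 (h.exchange ν ν' hp)
    have e2 := (exchange_iff q _ ν ν' hp).1 (h'.exchange ν ν' hp)
    have c1 : serL1 T' ν * serL2 T ν' = serL2 T ν' * serL1 T' ν :=
      serX_comm_serY _ _ fun m n => leg_comm _ _ fun i j k l => (hc _ _ _ _ _ _ _ _).symm
    have c2 : serL1 T ν * serL2 T' ν' = serL2 T' ν' * serL1 T ν :=
      serX_comm_serY _ _ fun m n => leg_comm _ _ fun i j k l => hc _ _ _ _ _ _ _ _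
    generalize Rser q A ν ν' = R at *
    generalize serL1 T ν = a at *
    generalize serL1 T' ν = a' at *
    generalize serL2 T ν' = b at *
    generalize serL2 T' ν' = b' at *
    calc R * (a * a' * (b * b')) = R * (a * (a' * b) * b') := by simp only [mul_assoc]
      _ = R * (a * b) * (a' * b') := by rw [c1]; simp only [mul_assoc]
      _ = b * a * (R * (a' * b')) := by rw [e1]; simp only [mul_assoc]
      _ = b * (a * b') * a' * R := by rw [e2]; simp only [mul_assoc]
      _ = b * b' * (a * a') * R := by rw [c2]; simp only [mul_assoc]

end Coproduct

/-- The images of the series under the coproduct,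
`Δ(L^±_{ij}(u)) = ∑_k L^±_{ik}(u) ⊗ L^±_{kj}(u)`. -/
def comulL (q : ℂˣ) : LData (LoopAlg q ⊗[ℂ] LoopAlg q) :=
  fun ν s => Matrix.of fun i j =>
    ∑ k, ∑ p ∈ Finset.HasAntidiagonal.antidiagonal s, genL q ν p.1 i k ⊗ₜ[ℂ] genL q ν p.2 k j

theorem comulL_eq (q : ℂˣ) :
    comulL q = LData.conv
      (fun ν s => (genL q ν s).map
        (Algebra.TensorProduct.includeLeft : LoopAlg q →ₐ[ℂ] LoopAlg q ⊗[ℂ] LoopAlg q))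
      (fun ν s => (genL q ν s).map
        (Algebra.TensorProduct.includeRight : LoopAlg q →ₐ[ℂ] LoopAlg q ⊗[ℂ] LoopAlg q)) := by
  funext ν s
  ext i j
  simp only [comulL, LData.conv, Matrix.of_apply, Matrix.sum_apply, Matrix.mul_apply,
    Matrix.map_apply, Algebra.TensorProduct.includeLeft_apply,
    Algebra.TensorProduct.includeRight_apply, Algebra.TensorProduct.tmul_mul_tmul, mul_one,
    one_mul]
  exact Finset.sum_comm

theorem isLOp_comulL (q : ℂˣ) : IsLOp q (comulL q) := by
  rw [comulL_eq]
  refine IsLOp.conv ((isLOp_genL q).map _) ((isLOp_genL q).map _) ?_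
  intro ν ν' m n i j k l
  simp

/-- The coproduct of the quantum loop algebra. -/
def comul (q : ℂˣ) : LoopAlg q →ₐ[ℂ] LoopAlg q ⊗[ℂ] LoopAlg q :=
  LoopAlg.lift (comulL q) (isLOp_comulL q)

/-! ## Modules -/

/-- The Verma module over `U_q(sl_2)` with highest weight `κ = q^Λ`: the quotient of
`U_q(sl_2)` by the left ideal generated by `E` and `q^H - κ`. -/
abbrev Verma (q κ : ℂˣ) : Type :=
  Uq q ⧸ Submodule.span (Uq q) {Uq.gen q .E, Uq.gen q .K - algebraMap ℂ (Uq q) κ}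

/-- The generating (highest weight) vector of the Verma module, the class of `1`. -/
def Verma.vac (q κ : ℂˣ) : Verma q κ := Submodule.Quotient.mk 1

/-- A module over the quantum loop algebra, given as a representation on a complex vector
space. -/
structure LoopMod (q : ℂˣ) where
  V : Type
  [grp : AddCommGroup V]
  [mod : Module ℂ V]
  ρ : LoopAlg q →ₐ[ℂ] Module.End ℂ V

attribute [instance] LoopMod.grp LoopMod.mod

/-- The evaluation module `V(z)` for the Verma module `V` with highest weight `κ`: the pullback
of `V` along `evalHom ∘ ρ_z`. -/
def evalMod (q κ z : ℂˣ) : LoopMod q where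
  V := Verma q κ
  ρ := (Algebra.lsmul ℂ ℂ (Verma q κ)).comp ((evalHom q).comp (shiftHom q z))

/-- The trivial one-dimensional module. -/
def trivMod (q : ℂˣ) : LoopMod q where
  V := ℂ
  ρ := (Algebra.ofId ℂ (Module.End ℂ ℂ)).comp (counit q)

/-- The tensor product of two modules, via the coproduct. -/
def tensorMod {q : ℂˣ} (W W' : LoopMod q) : LoopMod q where
  V := W.V ⊗[ℂ] W'.V
  ρ := (Module.endTensorEndAlgHom.comp (Algebra.TensorProduct.map W.ρ W'.ρ)).comp (comul q)

/-- The tensor product `W_0 ⊗ (W_1 ⊗ (⋯ ⊗ (W_{n-1} ⊗ ℂ)))` of `n` modules, where `ℂ` is the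
trivial module. -/
def tensorFamily {q : ℂˣ} : (n : ℕ) → (Fin n → LoopMod q) → LoopMod q
  | 0, _ => trivMod q
  | n + 1, W => tensorMod (W 0) (tensorFamily n fun m => W m.succ)

/-- The pure tensor `w_0 ⊗ w_1 ⊗ ⋯ ⊗ w_{n-1}`. -/
def pureTensor {q : ℂˣ} : (n : ℕ) → (W : Fin n → LoopMod q) → ((m : Fin n) → (W m).V) →
    (tensorFamily n W).V
  | 0, _, _ => (1 : ℂ)
  | n + 1, W, w => w 0 ⊗ₜ[ℂ] pureTensor n (fun m => W m.succ) fun m => w m.succ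

/-- The tensor product `V_0(z_0) ⊗ ⋯ ⊗ V_{n-1}(z_{n-1})` of evaluation Verma modules with
highest weights `κ_m = q^{Λ_m}`. -/
def evalTensor (q : ℂˣ) {n : ℕ} (κ z : Fin n → ℂˣ) : LoopMod q :=
  tensorFamily n fun m => evalMod q (κ m) (z m)

/-- The tensor product `v_0 ⊗ ⋯ ⊗ v_{n-1}` of the generating vectors. -/
def evalVac (q : ℂˣ) {n : ℕ} (κ z : Fin n → ℂˣ) : (evalTensor q κ z).V :=
  pureTensor n (fun m => evalMod q (κ m) (z m)) fun m => Verma.vac q (κ m)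

/-- The submodule over the quantum loop algebra generated by a vector. -/
def LoopMod.generated {q : ℂˣ} (W : LoopMod q) (w : W.V) : Submodule ℂ W.V :=
  LinearMap.range ((LinearMap.applyₗ w).comp W.ρ.toLinearMap)

/-- The operator `L^+_{ij}(c)` on a module on which the series `L^+_{ij}(u)` acts as a
polynomial in `u`, evaluated at the complex number `c`. -/
def LoopMod.Lplus {q : ℂˣ} (W : LoopMod q) (i j : Fin 2) (c : ℂ) : Module.End ℂ W.V :=
  ∑ᶠ s : ℕ, c ^ s • W.ρ (genL q .plus s i j)

theorem evalMod_genL_eq_zero (q κ z : ℂˣ) (s : ℕ) (hs : 1 < s) (i j : Fin 2) :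
    (evalMod q κ z).ρ (genL q .plus s i j) = 0 := by
  have h : evalHom q (shiftHom q z (genL q .plus s i j)) = 0 := by
    rw [shiftHom, LoopAlg.lift_genL, LData.rescale, Matrix.smul_apply, map_smul, evalHom,
      LoopAlg.lift_genL, evalL, evalMat, if_neg (by omega), if_neg (by omega)]
    simp
  change (Algebra.lsmul ℂ ℂ (Verma q κ)) (evalHom q (shiftHom q z (genL q .plus s i j))) = 0
  rw [h, map_zero]

/-- On a tensor product of `n` evaluation modules the series `L^+(u)` acts as a polynomial of
degree at most `n`, so that the sum defining `LoopMod.Lplus` is finite. -/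
theorem evalTensor_genL_eq_zero (q : ℂˣ) {n : ℕ} (κ z : Fin n → ℂˣ) (s : ℕ) (hs : n < s)
    (i j : Fin 2) : (evalTensor q κ z).ρ (genL q .plus s i j) = 0 := by
  induction n generalizing s i j with
  | zero =>
    have h : counit q (genL q .plus s i j) = 0 := by
      rw [counit, LoopAlg.lift_genL, counitL, if_neg (by omega)]
      rfl
    change (Algebra.ofId ℂ (Module.End ℂ ℂ)) (counit q (genL q .plus s i j)) = 0
    rw [h, map_zero]
  | succ n ih =>
    change Module.endTensorEndAlgHom (Algebra.TensorProduct.map (evalMod q (κ 0) (z 0)).ρ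
      (evalTensor q (fun m : Fin n => κ m.succ) (fun m => z m.succ)).ρ
        (comul q (genL q .plus s i j))) = 0
    rw [comul, LoopAlg.lift_genL, comulL, Matrix.of_apply, map_sum, map_sum]
    refine Finset.sum_eq_zero fun k _ => ?_
    rw [map_sum, map_sum]
    refine Finset.sum_eq_zero fun p hp => ?_
    rw [Finset.HasAntidiagonal.mem_antidiagonal] at hp
    rw [Algebra.TensorProduct.map_tmul]
    by_cases h : 1 < p.1
    · rw [evalMod_genL_eq_zero q _ _ _ h, TensorProduct.zero_tmul, map_zero]
    · rw [ih _ _ p.2 (by omega), TensorProduct.tmul_zero, map_zero]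

theorem evalTensor_Lplus_eq_sum (q : ℂˣ) {n : ℕ} (κ z : Fin n → ℂˣ) (i j : Fin 2) (c : ℂ) :
    (evalTensor q κ z).Lplus i j c
      = ∑ s ∈ Finset.range (n + 1), c ^ s • (evalTensor q κ z).ρ (genL q .plus s i j) := by
  refine finsum_eq_sum_of_support_subset _ fun s hs => ?_
  by_contra h
  refine hs ?_
  have h' : n < s := by simpa using h
  simp only [evalTensor_genL_eq_zero q κ z s h' i j, smul_zero]

end QLoop

end

/-!
Write `A, B, C, D` for the entries `L_{11}, L_{12}, L_{21}, L_{22}` of `L^+(u)`, put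
`t = q^{2Λ_j} z_j`, and call `t_s = q^{-2s} t`, `0 ≤ s ≤ ℓ`, a string. On a tensor product of
evaluation modules `L^+(u)` is a polynomial and `L^-(u)` is a scalar multiple of a power of `u`
times `L^+(u)` (`LoopMod.IsPolynomial`), so everything reduces to operators `L(u)`, `u ∈ ℂ`, with
the exchange relation `IsExchange`. The resonance condition says that the vacuum `v_j` is killed by
`D(t_0)` and `v_i` is killed by `A(t_ℓ)`.

*The singular vector.* On a string the `R`-matrix is degenerate, and
`A(t_s) B(t_{s+1}) = q⁻¹ B(t_s) A(t_{s+1})`. As `A(t_ℓ)` kills the vacuum, `A(x)` passes through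
`B(t_0) ⋯ B(t_ℓ)` without unwanted terms, and moving `C(x)` through the string leaves
`a(x) / (x - t_ℓ)` times a fixed vector, namely `∑_s q^{ℓ-s} B(t_0) ⋯ D(t_s) ⋯ B(t_ℓ)` applied to
the vacuum. That sum of operators is a multiple of `B(t_1) ⋯ B(t_ℓ) D(t_0)`
(`IsExchange.markedString_eq`), and `D(t_0)` kills the vacuum. The order of the tensor factors does
not matter here.

*The annihilated submodule.* The product `C(t_0) ⋯ C(t_ℓ)` is one entry of the fused operator, the
restriction of `L_{(1)}(t_0) ⋯ L_{(ℓ+1)}(t_ℓ)` to `q`-symmetric row vectors. By the exchange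
relation and the Yang–Baxter equation the common kernel of all entries of the fused operator is
a submodule (`IsExchange.apply_mem_fusedKernel`). It contains `v_1 ⊗ ⋯ ⊗ v_n`: the entries of the
fused operator multiply like matrices along the tensor product; on `v_i` only the last column
survives, because a column index `1` can be moved to the last place and meets `A(t_ℓ)` and `C`
there; and the bottom row then meets `v_j` further to the right, where only the corner entry
`D(t_0) ⋯ D(t_ℓ)` could survive, which vanishes.
-/

noncomputable section

namespace QLoop

/-! ### Exchange relations at complex values of the spectral parameters -/

section Exchange

variable {A : Type*} [Ring A] [Algebra ℂ A] {q : ℂˣ}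

/-- The homogeneous `R`-matrix `z R(u/z)` at complex numbers `u, z`. -/
def Rmat (q : ℂˣ) (u z : ℂ) : Matrix (Fin 2 × Fin 2) (Fin 2 × Fin 2) ℂ :=
  u • Rlin q + z • Rconst q

/-- A matrix of operator-valued functions `L(u)` of a complex number `u` satisfies
`R(u/z) L_{(1)}(u) L_{(2)}(z) = L_{(2)}(z) L_{(1)}(u) R(u/z)`. -/
def IsExchange (q : ℂˣ) (L : ℂ → Matrix (Fin 2) (Fin 2) A) : Prop :=
  ∀ u z, scal A (Rmat q u z) * (leg1 (L u) * leg2 (L z))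
    = (leg2 (L z) * leg1 (L u)) * scal A (Rmat q u z)

theorem scal_Rmat (u z : ℂ) :
    scal A (Rmat q u z) = u • scal A (Rlin q) + z • scal A (Rconst q) := by
  ext a b
  simp [scal, Rmat, Algebra.algebraMap_eq_smul_one, add_smul, mul_smul]

theorem IsExchange.entry {L : ℂ → Matrix (Fin 2) (Fin 2) A} (h : IsExchange q L) (u z : ℂ)
    (a b c d : Fin 2) :
    ∑ p : Fin 2 × Fin 2, Rmat q u z (a, b) p • (L u p.1 c * L z p.2 d)
      = ∑ p : Fin 2 × Fin 2, Rmat q u z p (c, d) • (L z b p.2 * L u a p.1) := by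
  have := congrFun (congrFun (h u z) (a, b)) (c, d)
  rw [Matrix.mul_apply, Matrix.mul_apply] at this
  simpa only [Fintype.sum_prod_type, leg1_mul_leg2_apply, leg2_mul_leg1_apply, scal,
    Matrix.map_apply, ← Algebra.smul_def, ← Algebra.commutes] using this

theorem Rmat_apply (q : ℂˣ) (u z : ℂ) (a b c d : Fin 2) : Rmat q u z (a, b) (c, d) =
    if a = b then (if a = c ∧ b = d then u * q - z * (q : ℂ)⁻¹ else 0)
    else if a = c ∧ b = d then u - z
    else if a = d ∧ b = c then ((q : ℂ) - (q : ℂ)⁻¹) * (if a = 0 then u else z) else 0 := by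
  fin_cases a <;> fin_cases b <;> fin_cases c <;> fin_cases d <;>
    simp [Rmat, Rlin, Rconst, unit2] <;> ring

namespace IsExchange

variable {L : ℂ → Matrix (Fin 2) (Fin 2) A}

theorem upper_comm (h : IsExchange q L) {u z : ℂ} (hp : u * q - z * (q : ℂ)⁻¹ ≠ 0) :
    L u 0 1 * L z 0 1 = L z 0 1 * L u 0 1 := by
  have := h.entry u z 0 0 1 1
  simp only [Fintype.sum_prod_type, Fin.sum_univ_two, Rmat_apply] at this
  simp only [reduceIte, and_self, zero_ne_one, one_ne_zero, false_and, and_false, zero_smul,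
    add_zero, zero_add] at this
  exact smul_right_injective A hp this

/-- `A` past `B`, with the unwanted term `B(x) A(t)`. -/
theorem mul_diag_upper (h : IsExchange q L) (x t : ℂ) :
    (x - t) • (L x 0 0 * L t 0 1) = (t * ((q : ℂ) - (q : ℂ)⁻¹)) • (L x 0 1 * L t 0 0)
      + ((q : ℂ)⁻¹ * (x - (q : ℂ) ^ 2 * t)) • (L t 0 1 * L x 0 0) := by
  have := h.entry t x 0 0 1 0
  simp only [Fintype.sum_prod_type, Fin.sum_univ_two, Rmat_apply] at this
  simp only [reduceIte, and_self, zero_ne_one, one_ne_zero, false_and, and_false, zero_smul,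
    add_zero, zero_add] at this
  have hq : (q : ℂ) ≠ 0 := q.ne_zero
  have e : ((q : ℂ)⁻¹ * (x - (q : ℂ) ^ 2 * t)) = - (t * q - x * (q : ℂ)⁻¹) := by
    field_simp
    ring
  rw [e, neg_smul, this]
  module

/-- `D` past `B`, with the unwanted term `B(u) D(z)`. -/
theorem lower_diag_mul_upper (h : IsExchange q L) (u z : ℂ) :
    (u - z) • (L u 1 1 * L z 0 1) + (((q : ℂ) - (q : ℂ)⁻¹) * z) • (L u 0 1 * L z 1 1)
      = (u * q - z * (q : ℂ)⁻¹) • (L z 0 1 * L u 1 1) := by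
  have := h.entry u z 1 0 1 1
  simp only [Fintype.sum_prod_type, Fin.sum_univ_two, Rmat_apply] at this
  simp only [reduceIte, and_self, zero_ne_one, one_ne_zero, false_and, and_false, zero_smul,
    add_zero, zero_add] at this
  rw [← this, add_comm]

theorem lower_mul_upper (h : IsExchange q L) (x t : ℂ) :
    (x - t) • (L x 1 0 * L t 0 1) = (x - t) • (L t 0 1 * L x 1 0)
      + (t * ((q : ℂ) - (q : ℂ)⁻¹)) • (L x 1 1 * L t 0 0 - L t 1 1 * L x 0 0) := by
  have := h.entry t x 0 1 1 0
  simp only [Fintype.sum_prod_type, Fin.sum_univ_two, Rmat_apply] at this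
  simp only [reduceIte, and_self, zero_ne_one, one_ne_zero, false_and, and_false, zero_smul,
    add_zero, zero_add] at this
  have e : (x - t) • (L x 1 0 * L t 0 1) = - ((t - x) • (L x 1 0 * L t 0 1)) := by module
  have e' := eq_sub_of_add_eq' this.symm
  rw [e, e']
  module

end IsExchange

/-- The ratio `q⁻²` of consecutive points of a string. -/
def ratio (q : ℂˣ) : ℂ := ((q : ℂ) ^ 2)⁻¹

theorem ratio_ne_zero (q : ℂˣ) : ratio q ≠ 0 := inv_ne_zero (pow_ne_zero 2 q.ne_zero)

theorem pow_coe_ne_one (hq : ¬ IsOfFinOrder q) {n : ℕ} (hn : n ≠ 0) : (q : ℂ) ^ n ≠ 1 := by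
  intro h
  exact hq (isOfFinOrder_iff_pow_eq_one.2 ⟨n, Nat.pos_of_ne_zero hn, Units.ext (by simpa using h)⟩)

theorem ratio_pow_ne_one (hq : ¬ IsOfFinOrder q) {n : ℕ} (hn : n ≠ 0) : ratio q ^ n ≠ 1 := by
  rw [ratio, inv_pow, ← pow_mul, Ne, inv_eq_one]
  exact pow_coe_ne_one hq (by omega)

theorem sub_inv_ne_zero (hq : ¬ IsOfFinOrder q) : (q : ℂ) - (q : ℂ)⁻¹ ≠ 0 := by
  intro h
  refine pow_coe_ne_one hq two_ne_zero ?_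
  rw [sq]
  nth_rewrite 2 [sub_eq_zero.1 h]
  exact mul_inv_cancel₀ q.ne_zero

theorem sub_ratio_ne_zero (hq : ¬ IsOfFinOrder q) {t : ℂ} (ht : t ≠ 0) (n : ℕ) :
    t * q - ratio q ^ n * t * (q : ℂ)⁻¹ ≠ 0 := by
  have hq0 : (q : ℂ) ≠ 0 := q.ne_zero
  have e : t * q - ratio q ^ n * t * (q : ℂ)⁻¹ = t * q * (1 - ratio q ^ (n + 1)) := by
    rw [pow_succ]
    nth_rewrite 3 [ratio]
    field_simp
  rw [e]
  exact mul_ne_zero (mul_ne_zero ht hq0) (sub_ne_zero.2 (ratio_pow_ne_one hq n.succ_ne_zero).symm)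

/-- At neighbouring points of a string the `R`-matrix is degenerate. The exchange relation applied
to the vector `e_2 ⊗ e_1 - q e_1 ⊗ e_2` spanning its kernel gives these three identities. -/
theorem IsExchange.string_swap (hq : ¬ IsOfFinOrder q) {L : ℂ → Matrix (Fin 2) (Fin 2) A}
    (h : IsExchange q L) {t : ℂ} (ht : t ≠ 0) :
    L t 0 1 * L (ratio q * t) 0 0 = (q : ℂ) • (L t 0 0 * L (ratio q * t) 0 1) ∧
    L t 1 1 * L (ratio q * t) 1 0 = (q : ℂ) • (L t 1 0 * L (ratio q * t) 1 1) ∧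
    L t 0 1 * L (ratio q * t) 1 0 + (q : ℂ) • (L t 1 1 * L (ratio q * t) 0 0)
      = (q : ℂ) • (L t 0 0 * L (ratio q * t) 1 1)
        + ((q : ℂ) * q) • (L t 1 0 * L (ratio q * t) 0 1) := by
  have hq0 : (q : ℂ) ≠ 0 := q.ne_zero
  have hp := sub_ratio_ne_zero hq ht 1
  rw [pow_one] at hp
  have hw := sub_inv_ne_zero hq
  have key : ∀ a b, (∑ p : Fin 2 × Fin 2, Rmat q t (ratio q * t) (a, b) p •
        (L t p.1 1 * L (ratio q * t) p.2 0))
      = (q : ℂ) • ∑ p : Fin 2 × Fin 2, Rmat q t (ratio q * t) (a, b) p •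
        (L t p.1 0 * L (ratio q * t) p.2 1) := by
    intro a b
    rw [h.entry, h.entry]
    simp only [Fintype.sum_prod_type, Fin.sum_univ_two, Rmat_apply]
    simp only [reduceIte, and_self, zero_ne_one, one_ne_zero, false_and, and_false, zero_smul,
      add_zero, zero_add, ratio]
    match_scalars <;> field_simp
  refine ⟨?_, ?_, ?_⟩
  · have := key 0 0
    simp only [Fintype.sum_prod_type, Fin.sum_univ_two, Rmat_apply] at this
    simp only [reduceIte, and_self, zero_ne_one, false_and, and_false, zero_smul,
      add_zero, smul_comm (q : ℂ)] at this
    exact smul_right_injective A hp this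
  · have := key 1 1
    simp only [Fintype.sum_prod_type, Fin.sum_univ_two, Rmat_apply] at this
    simp only [reduceIte, and_self, one_ne_zero, false_and, and_false, zero_smul,
      add_zero, zero_add, smul_comm (q : ℂ)] at this
    exact smul_right_injective A hp this
  · have := key 0 1
    simp only [Fintype.sum_prod_type, Fin.sum_univ_two, Rmat_apply] at this
    simp only [reduceIte, and_self, zero_ne_one, one_ne_zero, false_and, and_false, zero_smul,
      add_zero, zero_add, ratio] at this
    have hc : t * (q : ℂ)⁻¹ * ((q : ℂ) - (q : ℂ)⁻¹) ≠ 0 :=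
      mul_ne_zero (mul_ne_zero ht (inv_ne_zero hq0)) hw
    refine smul_right_injective A hc ?_
    simp only [ratio]
    refine Eq.trans ?_ (this.trans ?_)
    · match_scalars <;> field_simp
    · match_scalars <;> field_simp

/-! ### Bethe strings -/

/-- The product `B(t) B(q⁻² t) ⋯ B(q^{-2(N-1)} t)` of `B = L_{12}` over a string. -/
def upperString (q : ℂˣ) (L : ℂ → Matrix (Fin 2) (Fin 2) A) : ℂ → ℕ → A
  | _, 0 => 1
  | t, N + 1 => L t 0 1 * upperString q L (ratio q * t) N

/-- The sum `∑_s q^{N-1-s} B(t_0) ⋯ B(t_{s-1}) D(t_s) B(t_{s+1}) ⋯ B(t_{N-1})` over a string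
`t_s = q^{-2s} t`, where `B = L_{12}` and `D = L_{22}`. -/
def markedString (q : ℂˣ) (L : ℂ → Matrix (Fin 2) (Fin 2) A) : ℂ → ℕ → A
  | _, 0 => 0
  | t, N + 1 => L t 0 1 * markedString q L (ratio q * t) N
      + (q : ℂ) ^ N • (L t 1 1 * upperString q L (ratio q * t) N)

theorem upperString_succ {A : Type*} [Ring A] (L : ℂ → Matrix (Fin 2) (Fin 2) A) (t : ℂ) (N : ℕ) :
    upperString q L t (N + 1) = upperString q L t N * L (ratio q ^ N * t) 0 1 := by
  induction N generalizing t with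
  | zero => simp [upperString]
  | succ N ih =>
    rw [upperString, ih, upperString, mul_assoc, ← mul_assoc (ratio q ^ N), ← pow_succ]

theorem markedString_succ (L : ℂ → Matrix (Fin 2) (Fin 2) A) (t : ℂ) (N : ℕ) :
    markedString q L t (N + 1) = (q : ℂ) • (markedString q L t N * L (ratio q ^ N * t) 0 1)
      + upperString q L t N * L (ratio q ^ N * t) 1 1 := by
  induction N generalizing t with
  | zero => simp [markedString, upperString]
  | succ N ih =>
    rw [markedString, ih, upperString_succ, markedString, upperString]
    rw [← mul_assoc (ratio q ^ N), ← pow_succ]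
    simp only [mul_add, add_mul, smul_add, mul_assoc, mul_smul_comm, smul_mul_assoc, smul_smul,
      pow_succ', add_assoc, add_comm, add_left_comm]

namespace IsExchange

variable {L : ℂ → Matrix (Fin 2) (Fin 2) A}

theorem upperString_comm (hq : ¬ IsOfFinOrder q) (h : IsExchange q L) {t : ℂ} (ht : t ≠ 0)
    (N m : ℕ) : upperString q L (ratio q ^ m * t) N * L t 0 1
      = L t 0 1 * upperString q L (ratio q ^ m * t) N := by
  induction N generalizing m with
  | zero => simp [upperString]
  | succ N ih =>
    rw [upperString, ← mul_assoc (ratio q) _ t, ← pow_succ', mul_assoc, ih, ← mul_assoc,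
      ← h.upper_comm (sub_ratio_ne_zero hq ht m), mul_assoc]

theorem diag_mul_upperString (hq : ¬ IsOfFinOrder q) (h : IsExchange q L) {t : ℂ} (ht : t ≠ 0)
    (N : ℕ) : L t 0 0 * upperString q L (ratio q * t) N
      = (q : ℂ)⁻¹ ^ N • (upperString q L t N * L (ratio q ^ N * t) 0 0) := by
  induction N generalizing t with
  | zero => simp [upperString]
  | succ N ih =>
    have hr : ratio q * t ≠ 0 := mul_ne_zero (ratio_ne_zero q) ht
    have e : L t 0 0 * L (ratio q * t) 0 1 = (q : ℂ)⁻¹ • (L t 0 1 * L (ratio q * t) 0 0) := by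
      rw [(h.string_swap hq ht).1, smul_smul, inv_mul_cancel₀ q.ne_zero, one_smul]
    rw [upperString, ← mul_assoc, e, smul_mul_assoc, mul_assoc, ih hr, upperString, mul_smul_comm,
      smul_smul, ← pow_succ', ← mul_assoc, ← mul_assoc (ratio q ^ N), ← pow_succ]

/-- The marked sum telescopes: all terms combine into one in which `D` stands rightmost. -/
theorem markedString_eq (hq : ¬ IsOfFinOrder q) (h : IsExchange q L) {t : ℂ} (ht : t ≠ 0)
    (N : ℕ) : markedString q L t (N + 1) = (((q : ℂ) ^ (2 * (N + 1)) - 1) / ((q : ℂ) ^ 2 - 1)) •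
      (upperString q L (ratio q * t) N * L t 1 1) := by
  have hq0 : (q : ℂ) ≠ 0 := q.ne_zero
  have hq2 : (q : ℂ) ^ 2 - 1 ≠ 0 := sub_ne_zero.2 (pow_coe_ne_one hq two_ne_zero)
  induction N with
  | zero =>
    rw [zero_add, mul_one, div_self hq2]
    simp [markedString, upperString]
  | succ N ih =>
    have e1 : upperString q L t (N + 1) = upperString q L (ratio q * t) N * L t 0 1 := by
      have := h.upperString_comm hq ht N 1
      rw [pow_one] at this
      rw [upperString, this]
    rw [markedString_succ, ih, e1, upperString_succ, ← mul_assoc (ratio q ^ N), ← pow_succ]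
    set z := ratio q ^ (N + 1) * t with hz
    have hzt : z * (q : ℂ) ^ (2 * (N + 1)) = t := by
      rw [hz, ratio, inv_pow, ← pow_mul]
      field_simp
    have hz0 : z ≠ 0 := mul_ne_zero (pow_ne_zero _ (ratio_ne_zero q)) ht
    have hw := sub_inv_ne_zero hq
    have e2 := h.lower_diag_mul_upper t z
    have hc : ((q : ℂ) - (q : ℂ)⁻¹) * z ≠ 0 := mul_ne_zero hw hz0
    have e3 : (q : ℂ) - (q : ℂ)⁻¹ = (q : ℂ)⁻¹ * ((q : ℂ) ^ 2 - 1) := by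
      field_simp
    have c1 : ((q : ℂ) - (q : ℂ)⁻¹) * z * (q * (((q : ℂ) ^ (2 * (N + 1)) - 1) / ((q : ℂ) ^ 2 - 1)))
        = t - z := by
      rw [e3]
      field_simp
      rw [mul_sub, hzt, mul_one]
    have c2 : ((q : ℂ) - (q : ℂ)⁻¹) * z * (((q : ℂ) ^ (2 * (N + 1 + 1)) - 1) / ((q : ℂ) ^ 2 - 1))
        = t * q - z * (q : ℂ)⁻¹ := by
      rw [e3, ← hzt, mul_add 2 (N + 1) 1, mul_one, pow_add (q : ℂ) (2 * (N + 1)) 2]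
      field_simp
    have e4 : ((q : ℂ) * (((q : ℂ) ^ (2 * (N + 1)) - 1) / ((q : ℂ) ^ 2 - 1))) •
          (L t 1 1 * L z 0 1) + L t 0 1 * L z 1 1
        = (((q : ℂ) ^ (2 * (N + 1 + 1)) - 1) / ((q : ℂ) ^ 2 - 1)) • (L z 0 1 * L t 1 1) := by
      refine smul_right_injective A hc ?_
      simp only [smul_add, smul_smul, c1, c2]
      exact e2
    rw [smul_mul_assoc, smul_smul, mul_assoc, mul_assoc, mul_assoc, ← mul_smul_comm, ← mul_add,
      e4, mul_smul_comm]

end IsExchange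

end Exchange

section Singular

variable {V : Type*} [AddCommGroup V] [Module ℂ V] {q : ℂˣ}
  {L : ℂ → Matrix (Fin 2) (Fin 2) (Module.End ℂ V)}

/-- If `A = L_{11}` kills the vacuum at the last point of a string, then moving `A(x)` through
the string leaves no unwanted terms. -/
theorem IsExchange.diag_upperString_apply (hq : ¬ IsOfFinOrder q) (h : IsExchange q L) {v : V}
    {x a : ℂ} (hx : L x 0 0 v = a • v) (N : ℕ) {t : ℂ} (ht : t ≠ 0)
    (hA : L (ratio q ^ N * t) 0 0 v = 0) (hne : ∀ s < N, x ≠ ratio q ^ s * t) :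
    (x - ratio q ^ N * t) • L x 0 0 (upperString q L t (N + 1) v)
      = ((q : ℂ)⁻¹ ^ (N + 1) * (x - (q : ℂ) ^ 2 * t) * a) • upperString q L t (N + 1) v := by
  have hq0 : (q : ℂ) ≠ 0 := q.ne_zero
  have step : ∀ (t : ℂ) (y : V), L t 0 0 y = 0 → (x - t) • L x 0 0 (L t 0 1 y)
      = ((q : ℂ)⁻¹ * (x - (q : ℂ) ^ 2 * t)) • L t 0 1 (L x 0 0 y) := by
    intro t y hy
    have := congrArg (fun f => f y) (h.mul_diag_upper x t)
    simpa [hy] using this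
  induction N generalizing t with
  | zero =>
    rw [pow_zero, one_mul] at hA ⊢
    simp only [upperString, mul_one, zero_add, pow_one]
    rw [step t v hA, hx, map_smul, smul_smul]
  | succ N ih =>
    have hr : ratio q * t ≠ 0 := mul_ne_zero (ratio_ne_zero q) ht
    have hy : L t 0 0 (upperString q L (ratio q * t) (N + 1) v) = 0 := by
      have := congrArg (fun f => f v) (h.diag_mul_upperString hq ht (N + 1))
      simpa [hA] using this
    have hpow : ∀ s, ratio q ^ s * (ratio q * t) = ratio q ^ (s + 1) * t := by
      intro s
      rw [← mul_assoc, ← pow_succ]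
    have ih' := ih hr (by rwa [hpow]) fun s hs => by
      rw [hpow]
      exact hne (s + 1) (by omega)
    rw [hpow] at ih'
    have hxt : x - t ≠ 0 := sub_ne_zero.2 (by simpa using hne 0 (by omega))
    refine smul_right_injective V hxt ?_
    change (x - t) • (x - ratio q ^ (N + 1) * t) • L x 0 0 (L t 0 1 _) = (x - t) • _ • L t 0 1 _
    rw [smul_comm, step _ _ hy, smul_comm, ← map_smul, ih', map_smul, smul_smul, smul_smul]
    congr 1
    rw [← mul_assoc _ (ratio q), ratio, mul_inv_cancel₀ (pow_ne_zero 2 hq0), one_mul, pow_succ]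
    ring

/-- Moving `C(x)` through a string as in `diag_upperString_apply`. The factors `A(x)` picks up on
the way telescope, so that only the pole at the last point of the string remains. -/
theorem IsExchange.lower_upperString_apply (hq : ¬ IsOfFinOrder q) (h : IsExchange q L) {v : V}
    {x a : ℂ} (hx : L x 0 0 v = a • v) (hC : L x 1 0 v = 0) (N : ℕ) {t : ℂ} (ht : t ≠ 0)
    (hA : L (ratio q ^ N * t) 0 0 v = 0) (hne : ∀ s < N, x ≠ ratio q ^ s * t) :
    (x - ratio q ^ N * t) • L x 1 0 (upperString q L t (N + 1) v)
      = -((((q : ℂ) - (q : ℂ)⁻¹) * a * (ratio q ^ N * t)) • markedString q L t (N + 1) v) := by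
  have hq0 : (q : ℂ) ≠ 0 := q.ne_zero
  have step : ∀ (t : ℂ) (y : V), L t 0 0 y = 0 → (x - t) • L x 1 0 (L t 0 1 y)
      = (x - t) • L t 0 1 (L x 1 0 y)
        - (t * ((q : ℂ) - (q : ℂ)⁻¹)) • L t 1 1 (L x 0 0 y) := by
    intro t y hy
    have := congrArg (fun f => f y) (h.lower_mul_upper x t)
    simpa [hy, sub_eq_add_neg] using this
  induction N generalizing t with
  | zero =>
    rw [pow_zero, one_mul] at hA ⊢
    simp only [upperString, mul_one, zero_add, markedString, mul_zero, pow_zero, one_smul]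
    rw [step t v hA, hx, hC, map_zero, smul_zero, zero_sub, map_smul, smul_smul]
    congr 2
    ring
  | succ N ih =>
    have hr : ratio q * t ≠ 0 := mul_ne_zero (ratio_ne_zero q) ht
    have hy : L t 0 0 (upperString q L (ratio q * t) (N + 1) v) = 0 := by
      have := congrArg (fun f => f v) (h.diag_mul_upperString hq ht (N + 1))
      simpa [hA] using this
    have hpow : ∀ s, ratio q ^ s * (ratio q * t) = ratio q ^ (s + 1) * t := by
      intro s
      rw [← mul_assoc, ← pow_succ]
    have ih' := ih hr (by rwa [hpow]) fun s hs => by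
      rw [hpow]
      exact hne (s + 1) (by omega)
    have hdiag := h.diag_upperString_apply hq hx N hr (by rwa [hpow]) fun s hs => by
      rw [hpow]
      exact hne (s + 1) (by omega)
    rw [hpow] at ih' hdiag
    have hxt : x - t ≠ 0 := sub_ne_zero.2 (by simpa using hne 0 (by omega))
    refine smul_right_injective V hxt ?_
    change (x - t) • (x - ratio q ^ (N + 1) * t) • L x 1 0 (L t 0 1 _)
      = (x - t) • -(_ • (L t 0 1 _ + (q : ℂ) ^ (N + 1) • L t 1 1 _))
    rw [smul_comm, step _ _ hy, smul_sub, smul_comm _ (x - t), ← map_smul (L t 0 1), ih',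
      smul_comm _ (t * _), ← map_smul (L t 1 1), hdiag, map_neg, map_smul, map_smul]
    have e1 : (q : ℂ) ^ 2 * (ratio q * t) = t := by
      rw [← mul_assoc, ratio, mul_inv_cancel₀ (pow_ne_zero 2 hq0), one_mul]
    have e2 : ratio q ^ (N + 1) * t * (q : ℂ) ^ (N + 1) = t * (q : ℂ)⁻¹ ^ (N + 1) := by
      rw [ratio, inv_pow, inv_pow, ← pow_mul, two_mul, add_comm, pow_add]
      field_simp
    rw [e1]
    simp only [smul_add, smul_neg, smul_smul, neg_add, sub_eq_add_neg]
    congr 3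
    linear_combination (-1 : ℂ) * (x - t) * ((q : ℂ) - (q : ℂ)⁻¹) * a * e2

/-- A Bethe string whose ends are zeros of the vacuum eigenvalues of `D = L_{22}` and of
`A = L_{11}` produces a vector killed by `C(x) = L_{21}(x)` for all but finitely many `x`. -/
theorem IsExchange.lower_upperString_eq_zero (hq : ¬ IsOfFinOrder q) (h : IsExchange q L) {v : V}
    {x a : ℂ} (hx : L x 0 0 v = a • v) (hC : L x 1 0 v = 0) (N : ℕ) {t : ℂ} (ht : t ≠ 0)
    (hA : L (ratio q ^ N * t) 0 0 v = 0) (hD : L t 1 1 v = 0)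
    (hne : ∀ s ≤ N, x ≠ ratio q ^ s * t) :
    L x 1 0 (upperString q L t (N + 1) v) = 0 := by
  have e := h.lower_upperString_apply hq hx hC N ht hA fun s hs => hne s hs.le
  rw [h.markedString_eq hq ht, LinearMap.smul_apply, Module.End.mul_apply, hD, map_zero, smul_zero,
    smul_zero, neg_zero] at e
  exact (smul_eq_zero.1 e).resolve_left (sub_ne_zero.2 (hne N le_rfl))

end Singular

/-! ### Fused operators -/

section Fusion

variable {q : ℂˣ} {V W X Y : Type*} [AddCommGroup V] [Module ℂ V] [AddCommGroup W] [Module ℂ W]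
  [AddCommGroup X] [Module ℂ X] [AddCommGroup Y] [Module ℂ Y]

/-- A function on words in the indices of `ℂ²` is `q`-symmetric if it is a row vector over the
fused (symmetric) part of the tensor power: `ξ(…21…) = q ξ(…12…)`. -/
def IsQSymm (q : ℂˣ) (ξ : List (Fin 2) → X) : Prop :=
  ∀ as bs, ξ (as ++ 1 :: 0 :: bs) = (q : ℂ) • ξ (as ++ 0 :: 1 :: bs)

/-- The row vector `ξ` multiplied by `L_{(1)}(t) L_{(2)}(q⁻² t) ⋯ L_{(N)}(q^{-2(N-1)} t)`:
the value at a word `b` of length `N` is `∑_a ξ_a ∘ L_{a_1 b_1}(t) ⋯ L_{a_N b_N}(q^{-2(N-1)} t)`.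
The entries of `ξ` are maps out of the space on which `L` acts. -/
def rowAct (q : ℂˣ) (L : ℂ → Matrix (Fin 2) (Fin 2) (Module.End ℂ W)) :
    ℂ → (List (Fin 2) → W →ₗ[ℂ] X) → List (Fin 2) → W →ₗ[ℂ] X
  | _, ξ, [] => ξ []
  | t, ξ, b :: bs => rowAct q L (ratio q * t) (fun as => ∑ a, ξ (a :: as) ∘ₗ L t a b) bs

variable {L : ℂ → Matrix (Fin 2) (Fin 2) (Module.End ℂ W)}

theorem rowAct_add (t : ℂ) (ξ η : List (Fin 2) → W →ₗ[ℂ] X) (bs : List (Fin 2)) :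
    rowAct q L t (fun as => ξ as + η as) bs = rowAct q L t ξ bs + rowAct q L t η bs := by
  induction bs generalizing t ξ η with
  | nil => rfl
  | cons b bs ih =>
    simp only [rowAct]
    rw [← ih]
    simp only [LinearMap.add_comp, Finset.sum_add_distrib]

theorem rowAct_comp (f : X →ₗ[ℂ] Y) (t : ℂ) (ξ : List (Fin 2) → W →ₗ[ℂ] X)
    (bs : List (Fin 2)) : rowAct q L t (fun as => f ∘ₗ ξ as) bs = f ∘ₗ rowAct q L t ξ bs := by
  induction bs generalizing t ξ with
  | nil => rfl
  | cons b bs ih =>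
    simp only [rowAct]
    rw [← ih]
    congr 1
    funext as
    ext w
    simp

theorem rowAct_smul (c : ℂ) (t : ℂ) (ξ : List (Fin 2) → W →ₗ[ℂ] X) (bs : List (Fin 2)) :
    rowAct q L t (fun as => c • ξ as) bs = c • rowAct q L t ξ bs := by
  have := rowAct_comp (q := q) (L := L) (c • LinearMap.id) t ξ bs
  simpa [LinearMap.smul_comp] using this

theorem rowAct_zero (t : ℂ) (bs : List (Fin 2)) :
    rowAct q L t (fun _ => (0 : W →ₗ[ℂ] X)) bs = 0 := by
  simpa using rowAct_smul (q := q) (L := L) 0 t (fun _ => (0 : W →ₗ[ℂ] X)) bs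

theorem rowAct_sum {ι : Type*} (s : Finset ι) (t : ℂ) (ξ : ι → List (Fin 2) → W →ₗ[ℂ] X)
    (bs : List (Fin 2)) :
    rowAct q L t (fun as => ∑ i ∈ s, ξ i as) bs = ∑ i ∈ s, rowAct q L t (ξ i) bs := by
  classical
  induction s using Finset.induction_on with
  | empty => simpa using rowAct_zero t bs
  | insert i s hi ih => simp only [Finset.sum_insert hi, rowAct_add, ih]

theorem IsQSymm.cons {ξ : List (Fin 2) → X} (h : IsQSymm q ξ) (a : Fin 2) :
    IsQSymm q fun as => ξ (a :: as) := fun as bs => h (a :: as) bs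

theorem IsQSymm.row {ξ : List (Fin 2) → W →ₗ[ℂ] X} (h : IsQSymm q ξ)
    (M : Matrix (Fin 2) (Fin 2) (Module.End ℂ W)) (b : Fin 2) :
    IsQSymm q fun as => ∑ a, ξ (a :: as) ∘ₗ M a b := by
  intro as bs
  simp only [← List.cons_append, h _ bs, Finset.smul_sum, LinearMap.smul_comp]

theorem IsQSymm.rowAct (hq : ¬ IsOfFinOrder q) (hL : IsExchange q L) {t : ℂ} (ht : t ≠ 0)
    {ξ : List (Fin 2) → W →ₗ[ℂ] X} (h : IsQSymm q ξ) : IsQSymm q (rowAct q L t ξ) := by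
  intro as bs
  induction as generalizing t ξ with
  | nil =>
    obtain ⟨h1, h2, h3⟩ := hL.string_swap hq ht
    simp only [List.nil_append, QLoop.rowAct]
    rw [← rowAct_smul]
    congr 1
    funext as
    ext w
    have h1' := congrArg (fun f => ξ (0 :: 0 :: as) (f w)) h1
    have h2' := congrArg (fun f => ξ (1 :: 1 :: as) (f w)) h2
    have h3' := congrArg (fun f => ξ (0 :: 1 :: as) (f w)) h3
    have hs := h [] as
    simp only [List.nil_append] at hs
    simp only [Module.End.mul_apply, LinearMap.smul_apply, map_smul, LinearMap.add_apply,
      map_add] at h1' h2' h3'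
    simp only [Fin.sum_univ_two, LinearMap.add_apply, LinearMap.comp_apply, LinearMap.smul_apply,
      hs, h1', h2', smul_add]
    have h3'' := eq_sub_of_add_eq h3'
    rw [h3'']
    module
  | cons a as ih => exact ih (mul_ne_zero (ratio_ne_zero q) ht) (h.row _ _)

/-- If `C = L_{21}` kills `v`, and `A = L_{11}` kills `v` at the last point of the string (or the
row is supported on the word `2 ⋯ 2`), then a column index `1` anywhere in the word can be moved
to the last place, where it kills `v`. -/
theorem rowAct_apply_eq_zero (hq : ¬ IsOfFinOrder q) (hL : IsExchange q L) {v : W}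
    (hC : ∀ x, L x 1 0 v = 0) {t : ℂ} (ht : t ≠ 0) {ξ : List (Fin 2) → W →ₗ[ℂ] X}
    (hξ : IsQSymm q ξ) (bs : List (Fin 2))
    (hA : L (ratio q ^ (bs.length - 1) * t) 0 0 v = 0 ∨ ∀ as, 0 ∈ as → ξ as = 0)
    (hb : 0 ∈ bs) : rowAct q L t ξ bs v = 0 := by
  induction hn : bs.length generalizing bs t ξ with
  | zero => simp [List.length_eq_zero_iff.1 hn] at hb
  | succ n ih =>
    obtain ⟨b, bs, rfl⟩ := List.exists_cons_of_length_eq_add_one hn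
    have hn' : bs.length = n := by simpa using hn
    cases bs with
    | nil =>
      obtain rfl : b = 0 := by simpa [eq_comm] using hb
      rcases hA with hA | hA
      · simp only [List.length_cons, List.length_nil, zero_add, tsub_self, pow_zero, one_mul] at hA
        simp [rowAct, hA, hC]
      · simp [rowAct, hC, hA [0]]
    | cons c bs =>
      have key : ∀ b c, 0 ∈ c :: bs → rowAct q L t ξ (b :: c :: bs) v = 0 := by
        intro b c hb
        refine ih (mul_ne_zero (ratio_ne_zero q) ht) (hξ.row _ _) (c :: bs) ?_ hb
          (by simpa using hn')
        refine hA.imp (fun hA => ?_) fun hA as has => ?_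
        · simpa only [List.length_cons, Nat.add_sub_cancel, pow_succ, mul_assoc] using hA
        · simp [hA _ (List.mem_cons_of_mem _ has)]
      by_cases hc : 0 ∈ c :: bs
      · exact key b c hc
      obtain rfl : b = 0 := by
        rcases List.mem_cons.1 hb with h | h
        · exact h.symm
        · exact absurd h hc
      obtain rfl : c = 1 := by
        have : c ≠ 0 := fun h => hc (by simp [h])
        omega
      have hs := congrArg (fun f => f v) (hξ.rowAct hq hL ht [] bs)
      simp only [List.nil_append, LinearMap.smul_apply, key 1 0 (by simp)] at hs
      exact (smul_eq_zero.1 hs.symm).resolve_left q.ne_zero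

/-- The row vector supported on `2 ⋯ 2` picks out products of `D = L_{22}`. -/
theorem rowAct_replicate_apply {v : W} {d : ℂ → ℂ} (hD : ∀ x, L x 1 1 v = d x • v) (N : ℕ) {t : ℂ}
    (ht : d t = 0) {ξ : List (Fin 2) → W →ₗ[ℂ] X} (hξ : ∀ as, 0 ∈ as → ξ as = 0) :
    rowAct q L t ξ (List.replicate (N + 1) 1) v = 0 := by
  have key : ∀ (N : ℕ) (t : ℂ) (ξ : List (Fin 2) → W →ₗ[ℂ] X), (∀ as, 0 ∈ as → ξ as = 0) →
      ∃ c : ℂ, rowAct q L t ξ (List.replicate N 1) v = c • ξ (List.replicate N 1) v := by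
    intro N
    induction N with
    | zero => exact fun t ξ _ => ⟨1, by simp [rowAct]⟩
    | succ N ih =>
      intro t ξ hξ
      obtain ⟨c, hc⟩ := ih (ratio q * t) (fun as => ∑ a, ξ (a :: as) ∘ₗ L t a 1) fun as has => by
        simp [hξ _ (List.mem_cons_of_mem _ has)]
      refine ⟨c * d t, ?_⟩
      rw [List.replicate_succ, rowAct, hc]
      simp [hξ (0 :: _), hD, mul_smul]
  obtain ⟨c, hc⟩ := key N (ratio q * t) (fun as => ∑ a, ξ (a :: as) ∘ₗ L t a 1) fun as has => by
    simp [hξ _ (List.mem_cons_of_mem _ has)]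
  rw [List.replicate_succ, rowAct, hc]
  simp [hξ (0 :: _), hD, ht]

/-- The operators `∑_k L_{ik}(u) ⊗ L'_{kj}(u)` on a tensor product. -/
def tensorOp (L : ℂ → Matrix (Fin 2) (Fin 2) (Module.End ℂ V))
    (L' : ℂ → Matrix (Fin 2) (Fin 2) (Module.End ℂ W)) :
    ℂ → Matrix (Fin 2) (Fin 2) (Module.End ℂ (V ⊗[ℂ] W)) :=
  fun u => Matrix.of fun i j => ∑ k, TensorProduct.map (L u i k) (L' u k j)

/-- On a tensor product the row vector acts first through the first factor, which turns it into
a row vector of maps out of the second factor. -/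
theorem rowAct_tensorOp (L₁ : ℂ → Matrix (Fin 2) (Fin 2) (Module.End ℂ V))
    (L₂ : ℂ → Matrix (Fin 2) (Fin 2) (Module.End ℂ W)) (t : ℂ)
    (ξ : List (Fin 2) → V ⊗[ℂ] W →ₗ[ℂ] X) (bs : List (Fin 2)) (v : V) (w : W) :
    rowAct q (tensorOp L₁ L₂) t ξ bs (v ⊗ₜ w)
      = rowAct q L₂ t
          (fun cs => rowAct q L₁ t (fun as => TensorProduct.curry (ξ as)) cs v) bs w := by
  induction bs generalizing t ξ with
  | nil => rfl
  | cons b bs ih =>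
    rw [rowAct, ih, rowAct]
    congr 2
    funext cs
    simp only [rowAct]
    have e : ∀ as, TensorProduct.curry (∑ a, ξ (a :: as) ∘ₗ tensorOp L₁ L₂ t a b)
        = ∑ c, LinearMap.lcomp ℂ X (L₂ t c b) ∘ₗ
            ∑ a, TensorProduct.curry (ξ (a :: as)) ∘ₗ L₁ t a c := by
      intro as
      ext v' w'
      simp only [TensorProduct.curry_apply, LinearMap.sum_apply, LinearMap.comp_apply, tensorOp,
        Matrix.of_apply, TensorProduct.map_tmul, map_sum, LinearMap.lcomp_apply]
      exact Finset.sum_comm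
    simp only [e, rowAct_sum, rowAct_comp, LinearMap.sum_apply]
    rfl

/-! ### Products of `R`-matrices -/

/-- A row vector with values in `X` on `ℂ² ⊗ (ℂ²)^{⊗ N}` multiplied by the product
`R_{0N} ⋯ R_{02} R_{01}`, with parameter `u` in the zeroth place and a string starting at `t` in
the other places. -/
def rowR (q : ℂˣ) (u : ℂ) : ℂ → (Fin 2 → List (Fin 2) → X) → Fin 2 → List (Fin 2) → X
  | _, Ξ, d, [] => Ξ d []
  | t, Ξ, d, b :: bs => ∑ p : Fin 2 × Fin 2,
      Rmat q u t p (d, b) • rowR q u (ratio q * t) (fun e as => Ξ e (p.2 :: as)) p.1 bs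

theorem rowR_add (u t : ℂ) (Ξ Θ : Fin 2 → List (Fin 2) → X) (d : Fin 2) (bs : List (Fin 2)) :
    rowR q u t (fun e as => Ξ e as + Θ e as) d bs = rowR q u t Ξ d bs + rowR q u t Θ d bs := by
  induction bs generalizing t Ξ Θ d with
  | nil => rfl
  | cons b bs ih => simp only [rowR, ih, smul_add, Finset.sum_add_distrib]

theorem rowR_map (f : X →ₗ[ℂ] Y) (u t : ℂ) (Ξ : Fin 2 → List (Fin 2) → X) (d : Fin 2)
    (bs : List (Fin 2)) : rowR q u t (fun e as => f (Ξ e as)) d bs = f (rowR q u t Ξ d bs) := by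
  induction bs generalizing t Ξ d with
  | nil => rfl
  | cons b bs ih => simp only [rowR, ih, map_sum, map_smul]

theorem rowR_smul (c : ℂ) (u t : ℂ) (Ξ : Fin 2 → List (Fin 2) → X) (d : Fin 2)
    (bs : List (Fin 2)) : rowR q u t (fun e as => c • Ξ e as) d bs = c • rowR q u t Ξ d bs :=
  rowR_map (c • LinearMap.id) u t Ξ d bs

/-- The product of `R`-matrices preserves `q`-symmetry; the two-site case is a form of the
Yang–Baxter equation. -/
theorem IsQSymm.rowR (u t : ℂ) {Ξ : Fin 2 → List (Fin 2) → X}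
    (h : ∀ e, IsQSymm q (Ξ e)) (d : Fin 2) : IsQSymm q (rowR q u t Ξ d) := by
  have hq0 : (q : ℂ) ≠ 0 := q.ne_zero
  intro as bs
  induction as generalizing t Ξ d with
  | nil =>
    have hs : ∀ t' e, QLoop.rowR q u t' (fun e as => Ξ e (1 :: 0 :: as)) e bs
        = (q : ℂ) • QLoop.rowR q u t' (fun e as => Ξ e (0 :: 1 :: as)) e bs := by
      intro t' e
      rw [← rowR_smul]
      congr 1
      funext e as
      exact h e [] as
    simp only [List.nil_append, QLoop.rowR, Fintype.sum_prod_type, Fin.sum_univ_two, hs,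
      Rmat_apply]
    fin_cases d
    all_goals
      simp only [Fin.zero_eta, Fin.mk_one, reduceIte, and_self, zero_ne_one, one_ne_zero,
        false_and, and_false, zero_smul, add_zero, zero_add, ratio, smul_add, smul_smul]
      match_scalars
      all_goals
        field_simp
      all_goals ring
  | cons a as ih =>
    simp only [List.cons_append, QLoop.rowR, Finset.smul_sum]
    refine Finset.sum_congr rfl fun p _ => ?_
    rw [ih _ fun e => (h e).cons _, smul_comm]

theorem Rmat_vecMul_injective {u t : ℂ} (h1 : u ≠ (q : ℂ) ^ 2 * t) (h2 : u ≠ ratio q * t)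
    {x : Fin 2 × Fin 2 → X}
    (hx : ∀ d b, ∑ p : Fin 2 × Fin 2, Rmat q u t p (d, b) • x p = 0) : x = 0 := by
  have hq0 : (q : ℂ) ≠ 0 := q.ne_zero
  have hp : u * q - t * (q : ℂ)⁻¹ ≠ 0 := by
    have e : u * q - t * (q : ℂ)⁻¹ = q * (u - ratio q * t) := by
      rw [ratio]
      field_simp
    rw [e]
    exact mul_ne_zero hq0 (sub_ne_zero.2 h2)
  have hdet : (u - t) * (u - t) - u * t * ((q : ℂ) - (q : ℂ)⁻¹) ^ 2 ≠ 0 := by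
    have e : (u - t) * (u - t) - u * t * ((q : ℂ) - (q : ℂ)⁻¹) ^ 2
        = (u - (q : ℂ) ^ 2 * t) * (u - ratio q * t) := by
      rw [ratio]
      field_simp
      ring
    rw [e]
    exact mul_ne_zero (sub_ne_zero.2 h1) (sub_ne_zero.2 h2)
  have e00 := hx 0 0
  have e01 := hx 0 1
  have e10 := hx 1 0
  have e11 := hx 1 1
  simp only [Fintype.sum_prod_type, Fin.sum_univ_two, Rmat_apply] at e00 e01 e10 e11
  simp only [reduceIte, and_self, zero_ne_one, one_ne_zero, false_and, and_false, zero_smul,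
    add_zero, zero_add] at e00 e01 e10 e11
  have x00 := (smul_eq_zero.1 e00).resolve_left hp
  have x11 := (smul_eq_zero.1 e11).resolve_left hp
  have x01 : x (0, 1) = 0 := by
    refine (smul_eq_zero.1 ?_).resolve_left hdet
    have := congrArg₂ (fun a b => (u - t) • a - (((q : ℂ) - (q : ℂ)⁻¹) * t) • b) e01 e10
    simp only [smul_zero, sub_zero] at this
    rw [← this]
    module
  have x10 : x (1, 0) = 0 := by
    refine (smul_eq_zero.1 ?_).resolve_left hdet
    have := congrArg₂ (fun a b => (u - t) • b - (((q : ℂ) - (q : ℂ)⁻¹) * u) • a) e01 e10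
    simp only [smul_zero, sub_zero] at this
    rw [← this]
    module
  funext p
  obtain ⟨a, b⟩ := p
  fin_cases a <;> fin_cases b <;> assumption

/-- Away from the points where one of the `R`-matrices degenerates, their product is
invertible. -/
theorem rowR_injective {u : ℂ} (N : ℕ) {t : ℂ}
    (h1 : ∀ s < N, u ≠ (q : ℂ) ^ 2 * (ratio q ^ s * t))
    (h2 : ∀ s < N, u ≠ ratio q * (ratio q ^ s * t)) {Ξ : Fin 2 → List (Fin 2) → X}
    (hΞ : ∀ d bs, bs.length = N → rowR q u t Ξ d bs = 0) (d : Fin 2) (bs : List (Fin 2))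
    (hbs : bs.length = N) : Ξ d bs = 0 := by
  induction N generalizing t Ξ d bs with
  | zero =>
    obtain rfl := List.length_eq_zero_iff.1 hbs
    exact hΞ d [] rfl
  | succ N ih =>
    cases bs with
    | nil => simp at hbs
    | cons b bs =>
      have hs : ∀ s, ratio q ^ s * (ratio q * t) = ratio q ^ (s + 1) * t := by
        intro s
        rw [← mul_assoc, ← pow_succ]
      refine ih (t := ratio q * t) (Ξ := fun e as => Ξ e (b :: as)) (fun s hs' => ?_)
        (fun s hs' => ?_) (fun e as has => ?_) d bs (by simpa using hbs)
      · rw [hs]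
        exact h1 _ (by omega)
      · rw [hs]
        exact h2 _ (by omega)
      · have := Rmat_vecMul_injective (q := q) (u := u) (t := t)
          (by simpa using h1 0 (by omega)) (by simpa using h2 0 (by omega))
          (x := fun p => rowR q u (ratio q * t) (fun e as => Ξ e (p.2 :: as)) p.1 as)
          fun d b => hΞ d (b :: as) (by simp [has])
        exact congrFun this (e, b)

/-- The exchange relation between the product of `L`-operators over a string and `L(u)`. -/
theorem IsExchange.rowR_rowAct (hL : IsExchange q L) (u t : ℂ)
    (Ξ : Fin 2 → List (Fin 2) → W →ₗ[ℂ] X) (d : Fin 2) (bs : List (Fin 2)) :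
    rowR q u t (fun d bs => ∑ e, rowAct q L t (Ξ e) bs ∘ₗ L u e d) d bs
      = rowAct q L t (fun as => ∑ e, rowR q u t Ξ e as ∘ₗ L u e d) bs := by
  induction bs generalizing t Ξ d with
  | nil => rfl
  | cons b bs ih =>
    simp only [rowR, rowAct]
    simp only [ih (ratio q * t) (fun e as => ∑ a, Ξ e (a :: as) ∘ₗ L t a _)]
    simp only [← rowAct_smul, ← rowAct_sum]
    congr 1
    funext as
    have e1 : ∀ (a e : Fin 2), rowR q u (ratio q * t)
          (fun e as => ∑ a', Ξ e (a' :: as) ∘ₗ L t a' a) e as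
        = ∑ a', rowR q u (ratio q * t) (fun e as => Ξ e (a' :: as)) e as ∘ₗ L t a' a := by
      intro a e
      simp only [Fin.sum_univ_two]
      rw [rowR_add]
      congr 1
      · exact rowR_map (LinearMap.lcomp ℂ X (L t 0 a)) u _ (fun e as => Ξ e (0 :: as)) e as
      · exact rowR_map (LinearMap.lcomp ℂ X (L t 1 a)) u _ (fun e as => Ξ e (1 :: as)) e as
    simp only [e1]
    generalize hω : (fun (a' e : Fin 2) =>
      rowR q u (ratio q * t) (fun e as => Ξ e (a' :: as)) e as) = ω
    have hω' : ∀ a' e, rowR q u (ratio q * t) (fun e as => Ξ e (a' :: as)) e as = ω a' e := by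
      intro a' e
      rw [← hω]
    simp only [hω']
    ext w
    simp only [LinearMap.sum_apply, LinearMap.comp_apply, LinearMap.smul_apply, Finset.smul_sum]
    have hR : ∀ e a, _ := fun e a =>
      congrArg (fun f : Module.End ℂ W => ω a e (f w)) (hL.entry u t e a d b)
    simp only [LinearMap.sum_apply, LinearMap.smul_apply, Module.End.mul_apply, map_sum,
      map_smul] at hR
    trans ∑ e, ∑ a, ∑ p : Fin 2 × Fin 2, Rmat q u t p (d, b) • ω a e (L t a p.2 (L u e p.1 w))
    · rw [Finset.sum_comm]
      refine Finset.sum_congr rfl fun e _ => ?_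
      rw [Finset.sum_comm]
    · simp only [← hR, Fintype.sum_prod_type, Fin.sum_univ_two]
      abel

/-! ### The kernel of the fused operators -/

/-- The vectors killed by all fused operators of length `N` with string starting at `t`. The row
vectors take values in maps to an arbitrary space `X`, so that the condition can be tested one
tensor factor at a time. -/
def fusedKernel (q : ℂˣ) {W : Type} [AddCommGroup W] [Module ℂ W]
    (L : ℂ → Matrix (Fin 2) (Fin 2) (Module.End ℂ W)) (t : ℂ) (N : ℕ) : Submodule ℂ W where
  carrier := {w | ∀ (X : Type) [AddCommGroup X] [Module ℂ X] (ξ : List (Fin 2) → W →ₗ[ℂ] X),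
    IsQSymm q ξ → ∀ bs : List (Fin 2), bs.length = N → rowAct q L t ξ bs w = 0}
  add_mem' h h' X _ _ ξ hξ bs hbs := by
    rw [map_add, h X ξ hξ bs hbs, h' X ξ hξ bs hbs, add_zero]
  zero_mem' X _ _ ξ hξ bs hbs := map_zero _
  smul_mem' c w h X _ _ ξ hξ bs hbs := by
    rw [map_smul, h X ξ hξ bs hbs, smul_zero]

/-- For all but finitely many `u` the kernel of the fused operators is stable under `L(u)`: by the
exchange relation, a fused operator times `L(u)` is, up to invertible factors, `L(u)` times a fused
operator. -/
theorem IsExchange.apply_mem_fusedKernel {W : Type} [AddCommGroup W] [Module ℂ W]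
    {L : ℂ → Matrix (Fin 2) (Fin 2) (Module.End ℂ W)} (hL : IsExchange q L) {t : ℂ} {N : ℕ}
    {u : ℂ} (h1 : ∀ s < N, u ≠ (q : ℂ) ^ 2 * (ratio q ^ s * t))
    (h2 : ∀ s < N, u ≠ ratio q * (ratio q ^ s * t)) {w : W} (hw : w ∈ fusedKernel q L t N)
    (c d : Fin 2) : L u c d w ∈ fusedKernel q L t N := by
  intro X _ _ ξ hξ bs hbs
  -- The row `ξ` tensored with the `c`-th basis covector in the zeroth place.
  let Ξ : Fin 2 → List (Fin 2) → W →ₗ[ℂ] X := fun e as => if e = c then ξ as else 0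
  have hΞ : ∀ e, IsQSymm q (Ξ e) := by
    intro e as bs
    simp only [Ξ]
    split_ifs
    · exact hξ as bs
    · rw [smul_zero]
  have key := rowR_injective (q := q) (u := u) N (t := t) h1 h2
    (Ξ := fun d bs => (∑ e, rowAct q L t (Ξ e) bs ∘ₗ L u e d) w) (fun d bs hbs => by
      refine (rowR_map (LinearMap.applyₗ w) u t
        (fun d bs => ∑ e, rowAct q L t (Ξ e) bs ∘ₗ L u e d) d bs).trans ?_
      rw [hL.rowR_rowAct]
      refine hw X _ ?_ bs hbs
      intro as bs
      simp only [Finset.smul_sum, IsQSymm.rowR u t hΞ _ as bs, LinearMap.smul_comp]) d bs hbs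
  have e0 : rowAct q L t (Ξ c) = rowAct q L t ξ := by simp [Ξ]
  rw [LinearMap.sum_apply, Finset.sum_eq_single c] at key
  · rwa [e0] at key
  · intro e _ he
    simp only [Ξ, if_neg he, LinearMap.comp_apply]
    rw [rowAct_zero, LinearMap.zero_apply]
  · simp

end Fusion

/-! ### Membership of tensor products in the kernel -/

section FusedKernel

variable {q : ℂˣ} {V W : Type} [AddCommGroup V] [Module ℂ V] [AddCommGroup W] [Module ℂ W]
  {L : ℂ → Matrix (Fin 2) (Fin 2) (Module.End ℂ V)}
  {L' : ℂ → Matrix (Fin 2) (Fin 2) (Module.End ℂ W)} {v : V} {w : W} {t : ℂ} {N : ℕ}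

/-- The vector `w` is killed by the bottom row of the fused operator of length `N`, that is, by all
products `L_{2 b_1}(t) L_{2 b_2}(q⁻² t) ⋯ L_{2 b_N}(q^{-2(N-1)} t)`. -/
def KilledByBottomRow (q : ℂˣ) (L : ℂ → Matrix (Fin 2) (Fin 2) (Module.End ℂ W)) (t : ℂ) (N : ℕ)
    (w : W) : Prop :=
  ∀ (X : Type) [AddCommGroup X] [Module ℂ X] (ξ : List (Fin 2) → W →ₗ[ℂ] X),
    (∀ as, 0 ∈ as → ξ as = 0) → ∀ bs : List (Fin 2), bs.length = N → rowAct q L t ξ bs w = 0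

theorem isQSymm_of_support {X : Type*} [AddCommGroup X] [Module ℂ X] {ξ : List (Fin 2) → X}
    (h : ∀ as, 0 ∈ as → ξ as = 0) : IsQSymm q ξ := by
  intro as bs
  rw [h _ (by simp), h _ (by simp), smul_zero]

theorem eq_replicate_of_zero_notMem {bs : List (Fin 2)} (h : 0 ∉ bs) :
    bs = List.replicate bs.length 1 := by
  refine List.eq_replicate_of_mem fun b hb => ?_
  have : b ≠ 0 := fun e => h (e ▸ hb)
  omega

theorem IsQSymm.curry {X : Type*} [AddCommGroup X] [Module ℂ X]
    {ξ : List (Fin 2) → V ⊗[ℂ] W →ₗ[ℂ] X} (h : IsQSymm q ξ) :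
    IsQSymm q fun as => TensorProduct.curry (ξ as) := by
  intro as bs
  simp only [h as bs]
  rfl

theorem rowAct_congr {X : Type*} [AddCommGroup X] [Module ℂ X] {ξ η : List (Fin 2) → V →ₗ[ℂ] X}
    (t : ℂ) (bs : List (Fin 2)) (h : ∀ as, as.length = bs.length → ξ as = η as) :
    rowAct q L t ξ bs = rowAct q L t η bs := by
  induction bs generalizing t ξ η with
  | nil => exact h [] rfl
  | cons b bs ih =>
    refine ih _ fun as has => ?_
    simp only [h (_ :: as) (by simp [has])]

theorem tmul_mem_fusedKernel (hq : ¬ IsOfFinOrder q) (hL : IsExchange q L) (ht : t ≠ 0) (v : V)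
    (hw : w ∈ fusedKernel q L' t N) : v ⊗ₜ[ℂ] w ∈ fusedKernel q (tensorOp L L') t N := by
  intro X _ _ ξ hξ bs hbs
  rw [rowAct_tensorOp]
  refine hw X _ ?_ bs hbs
  intro as bs
  exact congrArg (fun f => f v) (hξ.curry.rowAct hq hL ht as bs)

/-- If `A = L_{11}` kills `v` at the last point of the string, only the last column of the fused
operator survives on `v`, so that the second factor meets the bottom row only. -/
theorem tmul_mem_fusedKernel_of_killed (hq : ¬ IsOfFinOrder q) (hL : IsExchange q L) (ht : t ≠ 0)
    (hC : ∀ x, L x 1 0 v = 0) (hA : L (ratio q ^ (N - 1) * t) 0 0 v = 0)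
    (hw : KilledByBottomRow q L' t N w) : v ⊗ₜ[ℂ] w ∈ fusedKernel q (tensorOp L L') t N := by
  classical
  intro X _ _ ξ hξ bs hbs
  rw [rowAct_tensorOp]
  -- Only words of length `N` matter, and on these the row is supported on `2 ⋯ 2`.
  rw [rowAct_congr (η := fun cs => if 0 ∈ cs then 0 else
    rowAct q L t (fun as => TensorProduct.curry (ξ as)) cs v) t bs fun cs hcs => ?_]
  · exact hw X _ (fun as has => if_pos has) bs hbs
  · split_ifs with h
    · refine rowAct_apply_eq_zero hq hL hC ht hξ.curry cs (Or.inl ?_) h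
      rwa [hcs, hbs]
    · rfl

theorem KilledByBottomRow.tmul (hq : ¬ IsOfFinOrder q) (hL : IsExchange q L) (ht : t ≠ 0)
    (hC : ∀ x, L x 1 0 v = 0) (hw : KilledByBottomRow q L' t N w) :
    KilledByBottomRow q (tensorOp L L') t N (v ⊗ₜ[ℂ] w) := by
  intro X _ _ ξ hξ bs hbs
  rw [rowAct_tensorOp]
  have hcurry : ∀ as, 0 ∈ as → TensorProduct.curry (ξ as) = 0 := by
    intro as has
    rw [hξ as has]
    rfl
  exact hw X _ (fun cs hcs => rowAct_apply_eq_zero hq hL hC ht (isQSymm_of_support hcurry) cs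
    (Or.inr hcurry) hcs) bs hbs

/-- The only entry of the bottom row not killing `v` for reasons of weight is the product of
`D = L_{22}` over the string, and its first factor vanishes on `v`. -/
theorem KilledByBottomRow.of_left (hq : ¬ IsOfFinOrder q) (hL : IsExchange q L) (ht : t ≠ 0)
    (hC : ∀ x, L x 1 0 v = 0) {d : ℂ → ℂ} (hD : ∀ x, L x 1 1 v = d x • v) (hd : d t = 0) (w : W) :
    KilledByBottomRow q (tensorOp L L') t (N + 1) (v ⊗ₜ[ℂ] w) := by
  intro X _ _ ξ hξ bs hbs
  rw [rowAct_tensorOp]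
  have hcurry : ∀ as, 0 ∈ as → TensorProduct.curry (ξ as) = 0 := by
    intro as has
    rw [hξ as has]
    rfl
  rw [rowAct_congr (η := fun _ => 0) t bs fun cs hcs => ?_]
  · rw [rowAct_zero, LinearMap.zero_apply]
  · by_cases h : 0 ∈ cs
    · exact rowAct_apply_eq_zero hq hL hC ht (isQSymm_of_support hcurry) cs (Or.inr hcurry) h
    · rw [eq_replicate_of_zero_notMem h, hcs, hbs]
      exact rowAct_replicate_apply hD N hd hcurry

/-- The product `L_{21}(t) L_{21}(q⁻² t) ⋯` over a string is a matrix entry of the fused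
operator. -/
theorem prod_lower_apply_eq_zero (hw : w ∈ fusedKernel q L' t N) :
    ((List.range N).map fun s => L' (ratio q ^ s * t) 1 0).prod w = 0 := by
  classical
  have key : ∀ (N : ℕ) (t : ℂ) (ξ : List (Fin 2) → W →ₗ[ℂ] W), (∀ as, 0 ∈ as → ξ as = 0) →
      rowAct q L' t ξ (List.replicate N 0)
        = ξ (List.replicate N 1) ∘ₗ
          ((List.range N).map fun s => L' (ratio q ^ s * t) 1 0).prod := by
    intro N
    induction N with
    | zero =>
      intro t ξ _
      rfl
    | succ N ih =>
      intro t ξ hξ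
      rw [List.replicate_succ, rowAct, ih _ _ fun as has => by
        simp [hξ _ (List.mem_cons_of_mem _ has)]]
      rw [List.range_succ_eq_map, List.map_cons, List.prod_cons, List.map_map]
      simp only [Fin.sum_univ_two, hξ (0 :: _) List.mem_cons_self, LinearMap.zero_comp, zero_add,
        LinearMap.comp_assoc, List.replicate_succ, pow_zero, one_mul]
      congr 3
      refine List.map_congr_left fun s _ => ?_
      rw [Function.comp_apply, pow_succ, mul_assoc]
  have hδ : ∀ as : List (Fin 2), 0 ∈ as →
      (if as = List.replicate N 1 then (LinearMap.id : W →ₗ[ℂ] W) else 0) = 0 := by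
    intro as has
    refine if_neg ?_
    rintro rfl
    simpa using List.eq_of_mem_replicate has
  have h := hw W _ (isQSymm_of_support hδ) (List.replicate N 0) (by simp)
  rw [key N t _ hδ, if_pos rfl] at h
  exact h

end FusedKernel

theorem upperString_eq_prod {A : Type*} [Ring A] (q : ℂˣ) (L : ℂ → Matrix (Fin 2) (Fin 2) A)
    (t : ℂ) (N : ℕ) :
    upperString q L t N = ((List.range N).map fun s => L (ratio q ^ s * t) 0 1).prod := by
  induction N with
  | zero => rfl
  | succ N ih => rw [upperString_succ, ih, List.range_succ]; simp

/-! ### Polynomial dependence on the spectral parameter -/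

/-- The coefficients of a vector-valued polynomial lie in a subspace as soon as all but finitely
many of its values do. -/
theorem coeff_mem_of_eval_mem {V : Type*} [AddCommGroup V] [Module ℂ V] (J : Submodule ℂ V)
    (f : ℕ → V) (n : ℕ) (S : Finset ℂ)
    (h : ∀ u ∉ S, ∑ s ∈ Finset.range n, u ^ s • f s ∈ J) : ∀ s < n, f s ∈ J := by
  intro s hs
  rw [← Submodule.Quotient.mk_eq_zero]
  rw [← Module.forall_dual_apply_eq_zero_iff ℂ]
  intro φ
  let P : Polynomial ℂ := ∑ s ∈ Finset.range n, Polynomial.monomial s (φ (J.mkQ (f s)))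
  have hP : P = 0 := by
    refine Polynomial.eq_zero_of_infinite_isRoot P (S.finite_toSet.infinite_compl.mono ?_)
    intro u hu
    have := (Submodule.Quotient.mk_eq_zero J).2 (h u hu)
    have e : φ (J.mkQ (∑ s ∈ Finset.range n, u ^ s • f s)) = 0 := by
      rw [Submodule.mkQ_apply, this, map_zero]
    simp only [map_sum, map_smul] at e
    simp only [Set.mem_ofPred_eq, Polynomial.IsRoot.def, P, Polynomial.eval_finsetSum,
      Polynomial.eval_monomial]
    rw [← e]
    exact Finset.sum_congr rfl fun s _ => mul_comm _ _
  have := congrArg (fun p => Polynomial.coeff p s) hP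
  simpa [P, Polynomial.finsetSum_coeff, Polynomial.coeff_monomial, hs] using this

/-- A polynomial `L^+(u)` satisfying the relations of the quantum loop algebra satisfies the
exchange relation at all complex values of the parameters. -/
theorem IsLOp.isExchange {A : Type*} [Ring A] [Algebra ℂ A] {q : ℂˣ} {T : LData A}
    (hT : IsLOp q T) (n : ℕ) (hn : ∀ s, n < s → T .plus s = 0) :
    IsExchange q fun u => ∑ s ∈ Finset.range (n + 1), u ^ s • T .plus s := by
  intro u z
  have hcoef : ∀ s : ℕ, T.coef .plus s = T .plus s := fun s => by simp [LData.coef]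
  have hneg : T.coef .plus (-1) = 0 := by simp [LData.coef]
  have e0 : ∀ (f : Matrix (Fin 2) (Fin 2) A → Matrix (Fin 2 × Fin 2) (Fin 2 × Fin 2) A),
      (f 0 = 0) → ∀ x : ℂ, ∑ s ∈ Finset.range (n + 2), x ^ s • f (T.coef .plus s)
        = ∑ s ∈ Finset.range (n + 1), x ^ s • f (T .plus s) := by
    intro f hf x
    rw [Finset.sum_range_succ]
    simp only [hcoef]
    rw [hn _ n.lt_succ_self, hf, smul_zero, add_zero]
  have e1 : ∀ (f : Matrix (Fin 2) (Fin 2) A → Matrix (Fin 2 × Fin 2) (Fin 2 × Fin 2) A),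
      (f 0 = 0) → ∀ x : ℂ, ∑ s ∈ Finset.range (n + 2), x ^ s • f (T.coef .plus (s - 1))
        = x • ∑ s ∈ Finset.range (n + 1), x ^ s • f (T .plus s) := by
    intro f hf x
    rw [Finset.sum_range_succ']
    simp only [Nat.cast_add, Nat.cast_one, add_sub_cancel_right, hcoef, Nat.cast_zero, zero_sub,
      hneg, hf, smul_zero, add_zero, Finset.smul_sum, smul_smul, pow_succ']
  have a0 := e0 leg1 leg1_zero u
  have a1 := e1 leg1 leg1_zero u
  have b0 := e0 leg2 leg2_zero z
  have b1 := e1 leg2 leg2_zero z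
  have l1 : leg1 (∑ s ∈ Finset.range (n + 1), u ^ s • T .plus s)
      = ∑ s ∈ Finset.range (n + 1), u ^ s • leg1 (T .plus s) := by
    simp only [leg1_sum, leg1_smul]
  have l2 : leg2 (∑ s ∈ Finset.range (n + 1), z ^ s • T .plus s)
      = ∑ s ∈ Finset.range (n + 1), z ^ s • leg2 (T .plus s) := by
    simp only [leg2_sum, leg2_smul]
  have key : ∑ r ∈ Finset.range (n + 2), ∑ s ∈ Finset.range (n + 2),
        (u ^ r * z ^ s) • rttL q T .plus .plus r s
      = ∑ r ∈ Finset.range (n + 2), ∑ s ∈ Finset.range (n + 2),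
        (u ^ r * z ^ s) • rttR q T .plus .plus r s :=
    Finset.sum_congr rfl fun r _ => Finset.sum_congr rfl fun s _ => by
      rw [hT.exchange _ _ (.same _)]
  have prod : ∀ (c : Matrix (Fin 2 × Fin 2) (Fin 2 × Fin 2) A)
      (f g : ℕ → Matrix (Fin 2 × Fin 2) (Fin 2 × Fin 2) A),
      ∑ r ∈ Finset.range (n + 2), ∑ s ∈ Finset.range (n + 2), (u ^ r * z ^ s) • (c * (f r * g s))
        = c * ((∑ r ∈ Finset.range (n + 2), u ^ r • f r) *
          ∑ s ∈ Finset.range (n + 2), z ^ s • g s) := by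
    intro c f g
    rw [Finset.sum_mul_sum]
    simp only [smul_mul_smul_comm]
    simp only [Finset.mul_sum, mul_smul_comm]
  have prod' : ∀ (c : Matrix (Fin 2 × Fin 2) (Fin 2 × Fin 2) A)
      (f g : ℕ → Matrix (Fin 2 × Fin 2) (Fin 2 × Fin 2) A),
      ∑ r ∈ Finset.range (n + 2), ∑ s ∈ Finset.range (n + 2), (u ^ r * z ^ s) • (g s * f r * c)
        = (∑ s ∈ Finset.range (n + 2), z ^ s • g s) *
          (∑ r ∈ Finset.range (n + 2), u ^ r • f r) * c := by
    intro c f g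
    rw [Finset.sum_mul_sum, Finset.sum_comm]
    simp only [smul_mul_smul_comm]
    simp only [mul_comm (u ^ _), Finset.sum_mul, smul_mul_assoc]
  have pL := fun c i j => prod c (fun r => leg1 (T.coef .plus ((r : ℤ) - i)))
    (fun s => leg2 (T.coef .plus ((s : ℤ) - j)))
  have pR := fun c i j => prod' c (fun r => leg1 (T.coef .plus ((r : ℤ) - i)))
    (fun s => leg2 (T.coef .plus ((s : ℤ) - j)))
  have pL0 := fun c => pL c 1 0
  have pL1 := fun c => pL c 0 1
  have pR0 := fun c => pR c 1 0
  have pR1 := fun c => pR c 0 1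
  simp only [sub_zero, a0, a1, b0, b1] at pL0 pL1 pR0 pR1
  simp only [rttL, rttR, smul_add, Finset.sum_add_distrib, pL0, pL1, pR0, pR1] at key
  dsimp only
  rw [scal_Rmat, l1, l2]
  simpa only [add_mul, mul_add, smul_mul_assoc, mul_smul_comm] using key

/-! ### Modules over the quantum loop algebra -/

section Modules

variable {q : ℂˣ}

/-- The matrix of the operators `L^+_{ij}(u)` on a module. -/
def LoopMod.Lmat (W : LoopMod q) (u : ℂ) : Matrix (Fin 2) (Fin 2) (Module.End ℂ W.V) :=
  Matrix.of fun i j => W.Lplus i j u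

/-- On `W` the series `L^+(u)` is a polynomial of degree at most `n`, and
`L^-(u) = c u^{-n} L^+(u)`. -/
structure LoopMod.IsPolynomial (W : LoopMod q) (n : ℕ) (c : ℂ) : Prop where
  plus_eq_zero : ∀ s, n < s → ∀ i j, W.ρ (genL q .plus s i j) = 0
  minus_eq_zero : ∀ s, n < s → ∀ i j, W.ρ (genL q .minus s i j) = 0
  minus_eq : ∀ s r, s + r = n → ∀ i j,
    W.ρ (genL q .minus s i j) = c • W.ρ (genL q .plus r i j)

theorem LoopMod.Lplus_eq_sum {W : LoopMod q} {n : ℕ}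
    (hW : ∀ s, n < s → ∀ i j, W.ρ (genL q .plus s i j) = 0) (i j : Fin 2) (u : ℂ) :
    W.Lplus i j u = ∑ s ∈ Finset.range (n + 1), u ^ s • W.ρ (genL q .plus s i j) := by
  refine finsum_eq_sum_of_support_subset _ fun s hs => ?_
  by_contra h
  refine hs ?_
  have h' : n < s := by simpa using h
  simp only [hW s h' i j, smul_zero]

theorem LoopMod.isExchange {W : LoopMod q} {n : ℕ}
    (hW : ∀ s, n < s → ∀ i j, W.ρ (genL q .plus s i j) = 0) : IsExchange q W.Lmat := by
  have h := ((isLOp_genL q).map W.ρ).isExchange n fun s hs => by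
    ext1 i j
    exact hW s hs i j
  convert h using 2 with u
  ext1 i j
  rw [LoopMod.Lmat, Matrix.of_apply, Lplus_eq_sum hW, Matrix.sum_apply]
  rfl

theorem tensorMod_ρ_genL (V W : LoopMod q) (ν : Sgn) (s : ℕ) (i j : Fin 2) :
    (tensorMod V W).ρ (genL q ν s i j)
      = ∑ k, ∑ p ∈ Finset.HasAntidiagonal.antidiagonal s,
          TensorProduct.map (V.ρ (genL q ν p.1 i k)) (W.ρ (genL q ν p.2 k j)) := by
  change Module.endTensorEndAlgHom (Algebra.TensorProduct.map V.ρ W.ρ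
    (comul q (genL q ν s i j))) = _
  rw [comul, LoopAlg.lift_genL, comulL, Matrix.of_apply]
  simp only [map_sum, Algebra.TensorProduct.map_tmul]
  rfl

theorem sum_antidiagonal_of_eq_zero {M : Type*} [AddCommMonoid M] (f : ℕ → ℕ → M)
    (hf : ∀ a b, 1 < a → f a b = 0) (s : ℕ) :
    ∑ p ∈ Finset.HasAntidiagonal.antidiagonal (s + 1), f p.1 p.2 = f 0 (s + 1) + f 1 s := by
  rw [Finset.Nat.sum_antidiagonal_succ]
  congr 1
  rw [Finset.sum_eq_single (0, s)]
  · rintro ⟨a, b⟩ hp hne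
    rw [Finset.HasAntidiagonal.mem_antidiagonal] at hp
    refine hf _ _ ?_
    by_contra h
    refine hne (Prod.ext ?_ ?_) <;> simp only at hp h ⊢ <;> omega
  · simp

theorem LoopMod.IsPolynomial.tensorMod {V W : LoopMod q} {n : ℕ} {c d : ℂ}
    (hV : V.IsPolynomial 1 c) (hW : W.IsPolynomial n d) :
    (tensorMod V W).IsPolynomial (n + 1) (c * d) := by
  have z1 : ∀ ν s i k r j, 1 < s →
      TensorProduct.map (V.ρ (genL q ν s i k)) (W.ρ (genL q ν r k j)) = 0 := by
    intro ν s i k r j hs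
    have : V.ρ (genL q ν s i k) = 0 := by
      cases ν
      · exact hV.plus_eq_zero s hs _ _
      · exact hV.minus_eq_zero s hs _ _
    rw [this, TensorProduct.map_zero_left]
  have z2 : ∀ ν s i k r j, n < r →
      TensorProduct.map (V.ρ (genL q ν s i k)) (W.ρ (genL q ν r k j)) = 0 := by
    intro ν s i k r j hr
    have : W.ρ (genL q ν r k j) = 0 := by
      cases ν
      · exact hW.plus_eq_zero r hr _ _
      · exact hW.minus_eq_zero r hr _ _
    rw [this, TensorProduct.map_zero_right]
  have hz : ∀ ν s, n + 1 < s → ∀ i j, (QLoop.tensorMod V W).ρ (genL q ν s i j) = 0 := by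
    intro ν s hs i j
    rw [tensorMod_ρ_genL]
    refine Finset.sum_eq_zero fun k _ => Finset.sum_eq_zero fun p hp => ?_
    rw [Finset.HasAntidiagonal.mem_antidiagonal] at hp
    by_cases h : 1 < p.1
    · exact z1 _ _ _ _ _ _ h
    · exact z2 _ _ _ _ _ _ (by omega)
  refine ⟨hz _, hz _, fun s r hsr i j => ?_⟩
  refine (tensorMod_ρ_genL V W .minus s i j).trans (Eq.trans ?_ (congrArg
    (fun f : Module.End ℂ (V.V ⊗[ℂ] W.V) => (c * d) • f) (tensorMod_ρ_genL V W .plus r i j).symm))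
  rw [Finset.smul_sum]
  refine Finset.sum_congr rfl fun k _ => ?_
  have m : ∀ s r s' r', s + s' = 1 → r + r' = n →
      TensorProduct.map (V.ρ (genL q .minus s i k)) (W.ρ (genL q .minus r k j))
        = (c * d) • TensorProduct.map (V.ρ (genL q .plus s' i k)) (W.ρ (genL q .plus r' k j)) := by
    intro s r s' r' h h'
    rw [hV.minus_eq s s' h, hW.minus_eq r r' h', TensorProduct.map_smul_left,
      TensorProduct.map_smul_right, smul_smul]
  have sA := fun ν => sum_antidiagonal_of_eq_zero (fun a b =>
    TensorProduct.map (V.ρ (genL q ν a i k)) (W.ρ (genL q ν b k j)))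
    (fun a b h => z1 _ _ _ _ _ _ h)
  cases s with
  | zero =>
    obtain rfl : r = n + 1 := by omega
    rw [sA, z2 .plus 0 i k (n + 1) j (by omega), zero_add, ← m 0 0 1 n rfl (by omega), Finset.Nat.antidiagonal_zero,
      Finset.sum_singleton]
  | succ s =>
    rw [sA]
    cases r with
    | zero =>
      obtain rfl : s = n := by omega
      rw [z2 .minus 0 i k (s + 1) j (by omega), zero_add, m 1 s 0 0 rfl rfl, Finset.Nat.antidiagonal_zero,
        Finset.sum_singleton]
    | succ r =>
      rw [sA, m 0 (s + 1) 1 r rfl (by omega), m 1 s 0 (r + 1) rfl (by omega), smul_add, add_comm]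

theorem tensorMod_Lmat {V W : LoopMod q} {n : ℕ}
    (hV : ∀ s, 1 < s → ∀ i j, V.ρ (genL q .plus s i j) = 0)
    (hW : ∀ s, n < s → ∀ i j, W.ρ (genL q .plus s i j) = 0)
    (hVW : ∀ s, n + 1 < s → ∀ i j, (tensorMod V W).ρ (genL q .plus s i j) = 0) :
    (tensorMod V W).Lmat = tensorOp V.Lmat W.Lmat := by
  funext u
  ext1 i j
  refine (LoopMod.Lplus_eq_sum hVW i j u).trans ((Finset.sum_congr rfl fun s _ => congrArg
    (fun f : Module.End ℂ (V.V ⊗[ℂ] W.V) => u ^ s • f)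
    (tensorMod_ρ_genL V W .plus s i j)).trans ?_)
  simp only [tensorOp, LoopMod.Lmat, Matrix.of_apply, LoopMod.Lplus_eq_sum hV,
    LoopMod.Lplus_eq_sum hW]
  simp only [Finset.smul_sum]
  rw [Finset.sum_comm]
  refine Finset.sum_congr rfl fun k _ => ?_
  simp only [← Finset.smul_sum]
  have sA := sum_antidiagonal_of_eq_zero (fun a b =>
    TensorProduct.map (V.ρ (genL q .plus a i k)) (W.ρ (genL q .plus b k j)))
    (fun a b h => by rw [hV a h, TensorProduct.map_zero_left])
  have hadd : ∀ (f g : Module.End ℂ V.V) (h : Module.End ℂ W.V),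
    TensorProduct.map (f + g) h = TensorProduct.map f h + TensorProduct.map g h :=
    fun f g h => TensorProduct.map_add_left f g h
  have hsum : ∀ (f : Module.End ℂ V.V), TensorProduct.map f
      (∑ s ∈ Finset.range (n + 1), u ^ s • W.ρ (genL q .plus s k j))
      = ∑ s ∈ Finset.range (n + 1), u ^ s • TensorProduct.map f (W.ρ (genL q .plus s k j)) := by
    intro f
    have := map_sum (TensorProduct.mapBilinear (RingHom.id ℂ) V.V W.V V.V W.V f)
      (fun s => u ^ s • W.ρ (genL q .plus s k j)) (Finset.range (n + 1))
    simpa only [TensorProduct.mapBilinear_apply, TensorProduct.map_smul_right] using this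
  rw [Finset.sum_range_succ', Finset.sum_congr rfl fun s _ => by rw [sA]]
  rw [Finset.sum_range_succ _ 1, Finset.range_one, Finset.sum_singleton, hadd, hsum, pow_zero,
    one_smul ℂ (V.ρ (genL q .plus 0 i k)), pow_one, TensorProduct.map_smul_left, hsum]
  simp only [smul_add, Finset.sum_add_distrib, Finset.smul_sum, smul_smul, ← pow_succ']
  have e : ∑ s ∈ Finset.range (n + 1),
        u ^ (s + 1) • TensorProduct.map (V.ρ (genL q .plus 0 i k)) (W.ρ (genL q .plus (s + 1) k j))
        + TensorProduct.map (V.ρ (genL q .plus 0 i k)) (W.ρ (genL q .plus 0 k j))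
      = ∑ s ∈ Finset.range (n + 1),
        u ^ s • TensorProduct.map (V.ρ (genL q .plus 0 i k)) (W.ρ (genL q .plus s k j)) := by
    rw [Finset.sum_range_succ, hW (n + 1) n.lt_succ_self, TensorProduct.map_zero_right, smul_zero,
      add_zero, Finset.sum_range_succ' _ n]
    simp
  rw [← e]
  rw [Finset.Nat.antidiagonal_zero, Finset.sum_singleton, one_smul]
  abel

/-- On a module on which `L^-(u)` is proportional to `L^+(u)`, a subspace stable under almost all
operators `L^+_{ij}(u)` is a submodule. -/
theorem LoopMod.IsPolynomial.mem_of_mem {W : LoopMod q} {n : ℕ} {c : ℂ} (hW : W.IsPolynomial n c)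
    (J : Submodule ℂ W.V) (S : Finset ℂ)
    (hJ : ∀ u ∉ S, ∀ i j, ∀ w ∈ J, W.Lmat u i j w ∈ J) (x : LoopAlg q) :
    ∀ w ∈ J, W.ρ x w ∈ J := by
  have hplus : ∀ s i j, ∀ w ∈ J, W.ρ (genL q .plus s i j) w ∈ J := by
    intro s i j w hw
    by_cases hs : s < n + 1
    · refine coeff_mem_of_eval_mem J (fun s => W.ρ (genL q .plus s i j) w) (n + 1) S
        (fun u hu => ?_) s hs
      have := hJ u hu i j w hw
      rw [LoopMod.Lmat, Matrix.of_apply, LoopMod.Lplus_eq_sum hW.plus_eq_zero] at this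
      simpa using this
    · rw [hW.plus_eq_zero s (by omega), LinearMap.zero_apply]
      exact J.zero_mem
  have hgen : ∀ ν s i j, ∀ w ∈ J, W.ρ (genL q ν s i j) w ∈ J := by
    intro ν s i j w hw
    cases ν with
    | plus => exact hplus s i j w hw
    | minus =>
      by_cases hs : s < n + 1
      · rw [hW.minus_eq s (n - s) (by omega), LinearMap.smul_apply]
        exact J.smul_mem _ (hplus _ i j w hw)
      · rw [hW.minus_eq_zero s (by omega), LinearMap.zero_apply]
        exact J.zero_mem
  obtain ⟨y, rfl⟩ := RingQuot.mkAlgHom_surjective ℂ (LoopRel q) x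
  let mk : FreeAlgebra ℂ LoopGen →ₐ[ℂ] LoopAlg q := RingQuot.mkAlgHom ℂ (LoopRel q)
  change ∀ w ∈ J, W.ρ (mk y) w ∈ J
  induction y using FreeAlgebra.induction with
  | grade0 r =>
    intro w hw
    rw [AlgHom.commutes, AlgHom.commutes, Module.algebraMap_end_apply]
    exact J.smul_mem r hw
  | grade1 g => exact hgen g.sgn g.s g.i g.j
  | mul a b ha hb =>
    intro w hw
    rw [map_mul, map_mul, Module.End.mul_apply]
    exact ha _ (hb _ hw)
  | add a b ha hb =>
    intro w hw
    rw [map_add, map_add, LinearMap.add_apply]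
    exact J.add_mem (ha _ hw) (hb _ hw)

end Modules

/-! ### Tensor products of evaluation modules -/

section Evaluation

variable (q : ℂˣ)

theorem evalMod_ρ_apply (κ z : ℂˣ) (ν : Sgn) (s : ℕ) (i j : Fin 2) (w : Verma q κ) :
    ((evalMod q κ z).ρ (genL q ν s i j) w : Verma q κ) = (evalL q).rescale z ν s i j • w := by
  change evalHom q (shiftHom q z (genL q ν s i j)) • w = _
  have : evalHom q (shiftHom q z (genL q ν s i j)) = (evalL q).rescale z ν s i j := by
    rw [shiftHom, LoopAlg.lift_genL]
    cases ν <;>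
      rw [LData.rescale, Matrix.smul_apply, map_smul, evalHom, LoopAlg.lift_genL, LData.rescale,
        Matrix.smul_apply]
  rw [this]

theorem evalMod_isPolynomial (κ z : ℂˣ) : (evalMod q κ z).IsPolynomial 1 (-z) where
  plus_eq_zero s hs i j := evalMod_genL_eq_zero q κ z s hs i j
  minus_eq_zero s hs i j := by
    refine LinearMap.ext fun w => (evalMod_ρ_apply q κ z .minus s i j w).trans ?_
    have h : (evalL q).rescale z .minus s i j = 0 := by
      simp only [LData.rescale, evalL]
      rw [evalMat, if_neg (by omega), if_neg (by omega), smul_zero, Matrix.zero_apply]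
    rw [h]
    exact zero_smul (Uq q) (show Verma q κ from w)
  minus_eq s r h i j := by
    have hz : (z : ℂ) ≠ 0 := z.ne_zero
    have hr : (1 : ℤ) - s = r := by omega
    have hsr : (s = 0 ∧ r = 1) ∨ (s = 1 ∧ r = 0) := by omega
    have e : (evalL q).rescale z .minus s i j
        = (-z : ℂ) • (evalL q).rescale z .plus r i j := by
      simp only [LData.rescale, evalL, hr, Matrix.smul_apply, Matrix.neg_apply, smul_smul,
        smul_neg, ← neg_smul]
      congr 1
      rcases hsr with ⟨rfl, rfl⟩ | ⟨rfl, rfl⟩ <;> simp [hz]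
    refine LinearMap.ext fun w => (evalMod_ρ_apply q κ z .minus s i j w).trans ?_
    rw [e]
    exact (smul_assoc (-z : ℂ) _ (show Verma q κ from w)).trans
      (congrArg (fun w : Verma q κ => (-z : ℂ) • w) (evalMod_ρ_apply q κ z .plus r i j w).symm)

theorem trivMod_ρ_apply (ν : Sgn) (s : ℕ) (i j : Fin 2) (w : ℂ) :
    ((trivMod q).ρ (genL q ν s i j) w : ℂ) = counitL ν s i j * w := by
  change (Algebra.ofId ℂ (Module.End ℂ ℂ)) (counit q (genL q ν s i j)) w = _
  rw [counit, LoopAlg.lift_genL]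
  rfl

theorem trivMod_isPolynomial : (trivMod q).IsPolynomial 0 1 := by
  have hz : ∀ ν s, 0 < s → ∀ i j, (trivMod q).ρ (genL q ν s i j) = 0 := by
    intro ν s hs i j
    refine LinearMap.ext fun w => (trivMod_ρ_apply q ν s i j w).trans ?_
    simp only [counitL, if_neg hs.ne', Matrix.zero_apply]
    exact zero_mul (show ℂ from w)
  refine ⟨hz _, hz _, fun s r h i j => ?_⟩
  obtain ⟨rfl, rfl⟩ : s = 0 ∧ r = 0 := by omega
  rw [one_smul]
  exact LinearMap.ext fun w =>
    (trivMod_ρ_apply q .minus 0 i j w).trans (trivMod_ρ_apply q .plus 0 i j w).symm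

theorem evalTensor_isPolynomial {n : ℕ} (κ z : Fin n → ℂˣ) :
    ∃ c, (evalTensor q κ z).IsPolynomial n c := by
  induction n with
  | zero => exact ⟨1, trivMod_isPolynomial q⟩
  | succ n ih =>
    obtain ⟨c, hc⟩ := ih (fun m => κ m.succ) fun m => z m.succ
    exact ⟨_, (evalMod_isPolynomial q (κ 0) (z 0)).tensorMod hc⟩

theorem evalTensor_isExchange {n : ℕ} (κ z : Fin n → ℂˣ) :
    IsExchange q (evalTensor q κ z).Lmat :=
  LoopMod.isExchange (evalTensor_isPolynomial q κ z).choose_spec.plus_eq_zero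

theorem evalMod_isExchange (κ z : ℂˣ) : IsExchange q (evalMod q κ z).Lmat :=
  LoopMod.isExchange (evalMod_isPolynomial q κ z).plus_eq_zero

theorem evalTensor_succ_Lmat {n : ℕ} (κ z : Fin (n + 1) → ℂˣ) :
    (evalTensor q κ z).Lmat = tensorOp (evalMod q (κ 0) (z 0)).Lmat
      (evalTensor q (fun m : Fin n => κ m.succ) fun m => z m.succ).Lmat :=
  tensorMod_Lmat (evalMod_isPolynomial q _ _).plus_eq_zero
    (evalTensor_isPolynomial q _ _).choose_spec.plus_eq_zero
    (evalTensor_isPolynomial q κ z).choose_spec.plus_eq_zero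

theorem evalTensor_succ_vac {n : ℕ} (κ z : Fin (n + 1) → ℂˣ) :
    evalVac q κ z = (show (evalMod q (κ 0) (z 0)).V from Verma.vac q (κ 0)) ⊗ₜ[ℂ]
      evalVac q (fun m : Fin n => κ m.succ) fun m => z m.succ := rfl

/-- The vector `v` is a highest weight vector: `L_{21}(x) v = 0`, `L_{11}(x) v = a(x) v` and
`L_{22}(x) v = d(x) v`. -/
structure IsHighestWeight {V : Type*} [AddCommGroup V] [Module ℂ V]
    (L : ℂ → Matrix (Fin 2) (Fin 2) (Module.End ℂ V)) (v : V) (a d : ℂ → ℂ) : Prop where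
  lower : ∀ x, L x 1 0 v = 0
  diag_zero : ∀ x, L x 0 0 v = a x • v
  diag_one : ∀ x, L x 1 1 v = d x • v

theorem IsHighestWeight.tmul {V W : Type*} [AddCommGroup V] [Module ℂ V] [AddCommGroup W]
    [Module ℂ W] {L : ℂ → Matrix (Fin 2) (Fin 2) (Module.End ℂ V)}
    {L' : ℂ → Matrix (Fin 2) (Fin 2) (Module.End ℂ W)} {v : V} {w : W} {a d a' d' : ℂ → ℂ}
    (h : IsHighestWeight L v a d) (h' : IsHighestWeight L' w a' d') :
    IsHighestWeight (tensorOp L L') (v ⊗ₜ[ℂ] w) (fun x => a x * a' x) fun x => d x * d' x where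
  lower x := by
    simp [tensorOp, h.lower, h'.lower]
  diag_zero x := by
    simp [tensorOp, h'.lower, h.diag_zero, h'.diag_zero, ← TensorProduct.smul_tmul', smul_smul,
      mul_comm]
  diag_one x := by
    simp [tensorOp, h.lower, h.diag_one, h'.diag_one, ← TensorProduct.smul_tmul', smul_smul,
      mul_comm]

theorem Verma.E_vac (κ : ℂˣ) : Uq.gen q .E • Verma.vac q κ = 0 := by
  rw [Verma.vac, ← Submodule.Quotient.mk_smul, Submodule.Quotient.mk_eq_zero, smul_eq_mul, mul_one]
  exact Submodule.subset_span (by simp)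

theorem Verma.K_vac (κ : ℂˣ) : Uq.gen q .K • Verma.vac q κ = (κ : ℂ) • Verma.vac q κ := by
  rw [← sub_eq_zero, ← algebraMap_smul (Uq q) (κ : ℂ) (Verma.vac q κ), ← sub_smul, Verma.vac,
    ← Submodule.Quotient.mk_smul, Submodule.Quotient.mk_eq_zero, smul_eq_mul, mul_one]
  exact Submodule.subset_span (by simp)

theorem Verma.Kinv_vac (κ : ℂˣ) :
    Uq.gen q .Kinv • Verma.vac q κ = (κ : ℂ)⁻¹ • Verma.vac q κ := by
  have h := congrArg (fun v => (κ : ℂ)⁻¹ • Uq.gen q .Kinv • v) (Verma.K_vac q κ)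
  simp only [smul_comm (Uq.gen q .Kinv) (κ : ℂ)] at h
  rw [smul_smul (κ : ℂ)⁻¹, inv_mul_cancel₀ κ.ne_zero, one_smul, smul_smul (Uq.gen q .Kinv),
    Uq.Kinv_K, one_smul] at h
  exact h.symm

theorem evalMod_isHighestWeight (κ z : ℂˣ) :
    IsHighestWeight (evalMod q κ z).Lmat (Verma.vac q κ : Verma q κ)
      (fun x => (κ : ℂ)⁻¹ - x * (z : ℂ)⁻¹ * κ) fun x => κ - x * (z : ℂ)⁻¹ * (κ : ℂ)⁻¹ := by
  have key : ∀ x i j, ((evalMod q κ z).Lmat x i j (Verma.vac q κ) : Verma q κ)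
      = -(evalMat q 0 i j • Verma.vac q κ)
        - (x * (z : ℂ)⁻¹) • evalMat q 1 i j • Verma.vac q κ := by
    intro x i j
    have h0 := evalMod_ρ_apply q κ z .plus 0 i j (Verma.vac q κ)
    have h1 := evalMod_ρ_apply q κ z .plus 1 i j (Verma.vac q κ)
    simp only [LData.rescale, evalL, pow_zero, one_smul, pow_one, Nat.cast_zero, Nat.cast_one,
      Matrix.neg_apply, Matrix.smul_apply, neg_smul, smul_neg, smul_assoc] at h0 h1
    rw [LoopMod.Lmat, Matrix.of_apply,
      LoopMod.Lplus_eq_sum (evalMod_isPolynomial q κ z).plus_eq_zero, Finset.sum_range_succ,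
      Finset.range_one, Finset.sum_singleton, pow_zero, one_smul, pow_one, sub_eq_add_neg, ← h0,
      mul_smul, ← smul_neg, ← h1]
    rfl
  refine ⟨fun x => (key x 1 0).trans ?_, fun x => (key x 0 0).trans ?_,
    fun x => (key x 1 1).trans ?_⟩
  · simp only [evalMat]
    simp [Verma.E_vac]
    rfl
  · have e : -(evalMat q 0 0 0 • Verma.vac q κ) - (x * (z : ℂ)⁻¹) • evalMat q 1 0 0 • Verma.vac q κ
        = ((κ : ℂ)⁻¹ - x * (z : ℂ)⁻¹ * κ) • Verma.vac q κ := by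
      simp [evalMat, Verma.K_vac, Verma.Kinv_vac]
      module
    exact e
  · have e : -(evalMat q 0 1 1 • Verma.vac q κ) - (x * (z : ℂ)⁻¹) • evalMat q 1 1 1 • Verma.vac q κ
        = ((κ : ℂ) - x * (z : ℂ)⁻¹ * (κ : ℂ)⁻¹) • Verma.vac q κ := by
      simp [evalMat, Verma.K_vac, Verma.Kinv_vac]
      module
    exact e

theorem evalTensor_isHighestWeight {n : ℕ} (κ z : Fin n → ℂˣ) :
    IsHighestWeight (evalTensor q κ z).Lmat (evalVac q κ z)
      (fun x => ∏ m, ((κ m : ℂ)⁻¹ - x * (z m : ℂ)⁻¹ * κ m))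
      fun x => ∏ m, ((κ m : ℂ) - x * (z m : ℂ)⁻¹ * (κ m : ℂ)⁻¹) := by
  induction n with
  | zero =>
    have key : ∀ x i j, (evalTensor q κ z).Lmat x i j (evalVac q κ z)
        = (if i = j then (1 : ℂ) else 0) • evalVac q κ z := by
      intro x i j
      rw [LoopMod.Lmat, Matrix.of_apply,
        LoopMod.Lplus_eq_sum (evalTensor_isPolynomial q κ z).choose_spec.plus_eq_zero,
        zero_add, Finset.range_one, Finset.sum_singleton, pow_zero, one_smul]
      refine (trivMod_ρ_apply q .plus 0 i j _).trans ?_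
      simp only [counitL, if_pos, Matrix.one_apply]
      rfl
    refine ⟨fun x => ?_, fun x => ?_, fun x => ?_⟩ <;> rw [key] <;> simp
  | succ n ih =>
    have h := (evalMod_isHighestWeight q (κ 0) (z 0)).tmul
      (ih (fun m => κ m.succ) fun m => z m.succ)
    rw [evalTensor_succ_Lmat]
    simp only [Fin.prod_univ_succ]
    exact h

end Evaluation

/-! ### The vacuum vector -/

section Vacuum

variable {q : ℂˣ}

theorem evalTensor_killedByBottomRow (hq : ¬ IsOfFinOrder q) {n : ℕ} (κ z : Fin n → ℂˣ)
    (j : Fin n) (N : ℕ) : KilledByBottomRow q (evalTensor q κ z).Lmat ((κ j : ℂ) ^ 2 * z j) (N + 1)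
      (evalVac q κ z) := by
  have ht : ∀ κ z : ℂˣ, (κ : ℂ) ^ 2 * z ≠ 0 := fun κ z =>
    mul_ne_zero (pow_ne_zero 2 κ.ne_zero) z.ne_zero
  induction n with
  | zero => exact j.elim0
  | succ n ih =>
    rw [evalTensor_succ_Lmat, evalTensor_succ_vac]
    have h0 := evalMod_isHighestWeight q (κ 0) (z 0)
    have hL := evalMod_isExchange q (κ 0) (z 0)
    refine Fin.cases ?_ (fun j => ?_) j
    · refine KilledByBottomRow.of_left hq hL (ht _ _) h0.lower h0.diag_one ?_ _
      have := (κ 0).ne_zero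
      have := (z 0).ne_zero
      field_simp
      ring
    · exact (ih (fun m => κ m.succ) (fun m => z m.succ) j).tmul hq hL (ht _ _) h0.lower

/-- If the factor whose vacuum is killed by `L_{11}` at the end of the string stands to the left of
the one whose vacuum is killed by `L_{22}` at its beginning, then the fused operators kill the
product of the vacuums. -/
theorem evalVac_mem_fusedKernel (hq : ¬ IsOfFinOrder q) {n : ℕ} (κ z : Fin n → ℂˣ) {i j : Fin n}
    (hij : i < j) (N : ℕ) (hz : (z i : ℂ) = (κ i : ℂ) ^ 2 * (ratio q ^ N * ((κ j : ℂ) ^ 2 * z j))) :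
    evalVac q κ z ∈ fusedKernel q (evalTensor q κ z).Lmat ((κ j : ℂ) ^ 2 * z j) (N + 1) := by
  have ht : ∀ κ z : ℂˣ, (κ : ℂ) ^ 2 * z ≠ 0 := fun κ z =>
    mul_ne_zero (pow_ne_zero 2 κ.ne_zero) z.ne_zero
  induction n with
  | zero => exact i.elim0
  | succ n ih =>
    rw [evalTensor_succ_Lmat, evalTensor_succ_vac]
    have h0 := evalMod_isHighestWeight q (κ 0) (z 0)
    have hL := evalMod_isExchange q (κ 0) (z 0)
    obtain ⟨j, rfl⟩ := Fin.exists_succ_eq.2 (Fin.ne_zero_of_lt hij)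
    induction i using Fin.cases with
    | zero =>
      refine tmul_mem_fusedKernel_of_killed hq hL (ht _ _) h0.lower ?_
        (evalTensor_killedByBottomRow hq _ _ j N)
      rw [h0.diag_zero, Nat.add_sub_cancel]
      have hκ := (κ 0).ne_zero
      have hx : ratio q ^ N * ((κ j.succ : ℂ) ^ 2 * z j.succ) = (z 0 : ℂ) * ((κ 0 : ℂ) ^ 2)⁻¹ := by
        rw [hz]
        field_simp
      rw [hx]
      have hz0 := (z 0).ne_zero
      have : ((κ 0 : ℂ)⁻¹ - (z 0 : ℂ) * ((κ 0 : ℂ) ^ 2)⁻¹ * (z 0 : ℂ)⁻¹ * κ 0) = 0 := by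
        field_simp
        ring
      rw [this]
      exact zero_smul ℂ (Verma.vac q (κ 0))
    | succ i =>
      exact tmul_mem_fusedKernel hq hL (ht _ _) _
        (ih (fun m => κ m.succ) (fun m => z m.succ) (Fin.succ_lt_succ_iff.1 hij) hz)

theorem generated_le_fusedKernel (hq : ¬ IsOfFinOrder q) {n : ℕ} (κ z : Fin n → ℂˣ) {i j : Fin n}
    (hij : i < j) (N : ℕ) (hz : (z i : ℂ) = (κ i : ℂ) ^ 2 * (ratio q ^ N * ((κ j : ℂ) ^ 2 * z j))) :
    (evalTensor q κ z).generated (evalVac q κ z)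
      ≤ fusedKernel q (evalTensor q κ z).Lmat ((κ j : ℂ) ^ 2 * z j) (N + 1) := by
  classical
  rintro _ ⟨x, rfl⟩
  obtain ⟨c, hc⟩ := evalTensor_isPolynomial q κ z
  set t := (κ j : ℂ) ^ 2 * z j
  refine hc.mem_of_mem _ ((Finset.range (N + 1)).image (fun s => (q : ℂ) ^ 2 * (ratio q ^ s * t)) ∪
    (Finset.range (N + 1)).image fun s => ratio q * (ratio q ^ s * t)) (fun u hu a b w hw => ?_) x _
    (evalVac_mem_fusedKernel hq κ z hij N hz)
  simp only [Finset.mem_union, Finset.mem_image, Finset.mem_range, not_or, not_exists,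
    not_and] at hu
  exact (evalTensor_isExchange q κ z).apply_mem_fusedKernel (fun s hs => (hu.1 s hs ·.symm))
    (fun s hs => (hu.2 s hs ·.symm)) hw a b

/-- The Bethe string joining the zeros of the two vacuum eigenvalues gives a singular vector,
whatever the order of the factors. -/
theorem lower_upperString_evalVac (hq : ¬ IsOfFinOrder q) {n : ℕ} (κ z : Fin n → ℂˣ) (i j : Fin n)
    (N : ℕ) (hz : (z i : ℂ) = (κ i : ℂ) ^ 2 * (ratio q ^ N * ((κ j : ℂ) ^ 2 * z j)))
    (ν : Sgn) (k : ℕ) : (evalTensor q κ z).ρ (genL q ν k 1 0)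
      (upperString q (evalTensor q κ z).Lmat ((κ j : ℂ) ^ 2 * z j) (N + 1) (evalVac q κ z)) = 0 := by
  classical
  obtain ⟨c, hc⟩ := evalTensor_isPolynomial q κ z
  have hw := evalTensor_isHighestWeight q κ z
  have hκ := fun m => (κ m).ne_zero
  have hz0 := fun m => (z m).ne_zero
  set t := (κ j : ℂ) ^ 2 * z j with ht
  have ht0 : t ≠ 0 := mul_ne_zero (pow_ne_zero 2 (hκ j)) (hz0 j)
  have hA : (evalTensor q κ z).Lmat (ratio q ^ N * t) 0 0 (evalVac q κ z) = 0 := by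
    rw [hw.diag_zero, Finset.prod_eq_zero (Finset.mem_univ i), zero_smul]
    have hx : ratio q ^ N * t = (z i : ℂ) * ((κ i : ℂ) ^ 2)⁻¹ := by
      have := hκ i
      rw [hz]
      field_simp
    rw [hx]
    have := hκ i
    have := hz0 i
    field_simp
    ring
  have hD : (evalTensor q κ z).Lmat t 1 1 (evalVac q κ z) = 0 := by
    rw [hw.diag_one, Finset.prod_eq_zero (Finset.mem_univ j), zero_smul]
    rw [ht]
    have := hκ j
    have := hz0 j
    field_simp
    ring
  set y := upperString q (evalTensor q κ z).Lmat t (N + 1) (evalVac q κ z)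
  have hplus : ∀ k, (evalTensor q κ z).ρ (genL q .plus k 1 0) y = 0 := by
    intro k
    by_cases hk : k < n + 1
    · rw [← Submodule.mem_bot ℂ]
      refine coeff_mem_of_eval_mem ⊥ (fun s => (evalTensor q κ z).ρ (genL q .plus s 1 0) y) (n + 1)
        ((Finset.range (N + 1)).image fun s => ratio q ^ s * t) (fun u hu => ?_) k hk
      simp only [Finset.mem_image, Finset.mem_range, not_exists, not_and] at hu
      have := (evalTensor_isExchange q κ z).lower_upperString_eq_zero hq (hw.diag_zero u)
        (hw.lower u) N ht0 hA hD fun s hs => (hu s (by omega) ·.symm)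
      rw [LoopMod.Lmat, Matrix.of_apply, LoopMod.Lplus_eq_sum hc.plus_eq_zero] at this
      rw [Submodule.mem_bot, ← this]
      simp [y]
    · rw [hc.plus_eq_zero k (by omega), LinearMap.zero_apply]
  cases ν with
  | plus => exact hplus k
  | minus =>
    by_cases hk : k < n + 1
    · rw [hc.minus_eq k (n - k) (by omega), LinearMap.smul_apply, hplus, smul_zero]
    · rw [hc.minus_eq_zero k (by omega), LinearMap.zero_apply]

end Vacuum

end QLoop

end

theorem proposition3p1 (q : ℂˣ) (hq : ¬ IsOfFinOrder q) (n ℓ : ℕ) (κ z : Fin n → ℂˣ)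
    (i j : Fin n) (hij : i < j)
    (hz : z i = κ i ^ 2 * κ j ^ 2 * (q ^ (2 * ℓ))⁻¹ * z j) :
    (∀ w ∈ (QLoop.evalTensor q κ z).generated (QLoop.evalVac q κ z),
      ((List.range (ℓ + 1)).map fun s =>
        (QLoop.evalTensor q κ z).Lplus 1 0 ((κ j ^ 2 * (q ^ (2 * s))⁻¹ * z j : ℂˣ) : ℂ)).prod w
          = 0) ∧
    (∀ (ν : QLoop.Sgn) (k : ℕ),
      (QLoop.evalTensor q (κ ∘ Fin.rev) (z ∘ Fin.rev)).ρ (QLoop.genL q ν k 1 0)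
        (((List.range (ℓ + 1)).map fun s =>
          (QLoop.evalTensor q (κ ∘ Fin.rev) (z ∘ Fin.rev)).Lplus 0 1
            ((κ j ^ 2 * (q ^ (2 * s))⁻¹ * z j : ℂˣ) : ℂ)).prod
          (QLoop.evalVac q (κ ∘ Fin.rev) (z ∘ Fin.rev))) = 0) := by
  have hpt : ∀ s, ((κ j ^ 2 * (q ^ (2 * s))⁻¹ * z j : ℂˣ) : ℂ)
      = QLoop.ratio q ^ s * ((κ j : ℂ) ^ 2 * z j) := by
    intro s
    rw [QLoop.ratio, inv_pow, ← pow_mul]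
    push_cast
    ring
  have hz' : (z i : ℂ) = (κ i : ℂ) ^ 2 * (QLoop.ratio q ^ ℓ * ((κ j : ℂ) ^ 2 * z j)) := by
    rw [← hpt, hz]
    push_cast
    ring
  simp only [hpt]
  refine ⟨fun w hw => ?_, fun ν k => ?_⟩
  · exact QLoop.prod_lower_apply_eq_zero (QLoop.generated_le_fusedKernel hq κ z hij ℓ hz' hw)
  · have h := QLoop.lower_upperString_evalVac hq (κ ∘ Fin.rev) (z ∘ Fin.rev) (Fin.rev i)
      (Fin.rev j) ℓ (by simpa using hz') ν k
    rw [QLoop.upperString_eq_prod] at h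
    simp only [Function.comp_apply, Fin.rev_rev] at h
    exact h
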